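/- Let $\mathbb{G}=(\mathbb{R}^N,*)$ be a stratified Lie group (homogeneous Carnot group), let $X_1,\dots,X_{N_1}$ be its left-invariant horizontal vector fields with $X_i(0)=\partial_{x_i}|_0$, and put $\nabla_{\mathbb{G}}=(X_1,\dots,X_{N_1})$, $\mathcal{L}=X_1^2+\dots+X_{N_1}^2$. Let $\Omega\subset\mathbb{G}$ be a bounded domain, $\lambda>0$, and $f\in L^\infty(\Omega)$ with $f>0$ a.e. in $\Omega$. The space $W^{1,2}(\Omega)$ consists of the $u\in L^2(\Omega)$ with weak horizontal gradient $\nabla_{\mathbb{G}}u\in L^2(\Omega)$, with norm $\|u\|_{L^2(\Omega)}+\|\nabla_{\mathbb{G}}u\|_{L^2(\Omega)}$, and $W^{1,2}_0(\Omega)$ is the closure of $C_c^\infty(\Omega)$ in it. Let $g:\mathbb{R}\to[0,2]$ be smooth, positive on $(0,1)$, zero elsewhere, with $\int_0^1 g=1$, let $G(t)=\int_0^t g$, and for $\alpha>0$ put $$I_\alpha(u)=\int_\Omega\frac{|\nabla_{\mathbb{G}}u|^2}{2}\,dx+\int_\Omega G\Big(\frac{u-1}{\alpha}\Big)dx-\frac{\lambda}{3}\int_\Omega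 (u-1)_+^3 f\,dx .$$ Call $v\in W^{1,2}_0(\Omega)\cap L^\infty(\Omega)$ a critical point of $I_\alpha$ if $\frac{d}{dt}I_\alpha(v+t\varphi)|_{t=0}=0$ for every $\varphi\in C_c^\infty(\Omega)$. Let $\alpha_j>0$, $\alpha_j\to0$, let $u_j$ be critical points of $I_{\alpha_j}$ that are bounded in $W^{1,2}_0(\Omega)\cap L^\infty(\Omega)$, and suppose that $u_j\to u$ uniformly on $\Omega$ with $u$ continuous on $\Omega$. Then: 1. $u\in W^{1,2}_{\rm loc}(\Omega)$. 2. With $(u-1)_-=\max\{1-u,0\}$, the distribution $\mathcal{L}(u-1)_-$ on $\Omega$ is a nonnegative Radon measure: there is a Radon measure $\mathcal{M}\ge0$ on $\Omega$ with $$\int_\Omega (u-1)_-\,\mathcal{L}\varphi\,dx=\int_\Omega\varphi\,d\mathcal{M}\qquad\text{for all }\varphi\in C_c^\infty(\Omega),$$ and $\mathcal{M}$ is supported on $\Omega\cap\partial\{u<1\}$, that is, $\mathcal{M}(\Omega\setminus\partial\{u<1\})=0$. -/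

import Mathlib

open MeasureTheory Filter Topology
open scoped ContDiff

noncomputable section

namespace Stratified

/-- The left invariant vector field with value `∂/∂xᵢ` at the origin, for a composition law
`mul` on `ℝ^N` with identity `0`: its value at `x` is the image of `eᵢ` under the differential
at `0` of the left translation `y ↦ x * y`. -/
def leftInvField {N : ℕ} (mul : (Fin N → ℝ) → (Fin N → ℝ) → (Fin N → ℝ)) (i : Fin N)
    (x : Fin N → ℝ) : Fin N → ℝ :=
  fderiv ℝ (fun y => mul x y) 0 (Pi.single i 1)

/-- The iterated commutators (of any length `≥ 1`) of a set `S` of vector fields on `ℝ^N`. -/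
inductive IterCommutator {N : ℕ} (S : Set ((Fin N → ℝ) → (Fin N → ℝ))) :
    ((Fin N → ℝ) → (Fin N → ℝ)) → Prop
  | base (V : (Fin N → ℝ) → (Fin N → ℝ)) (hV : V ∈ S) : IterCommutator S V
  | bracket (V W : (Fin N → ℝ) → (Fin N → ℝ)) (hV : IterCommutator S V)
      (hW : IterCommutator S W) : IterCommutator S (VectorField.lieBracket ℝ V W)

/-- A stratified Lie group (homogeneous Carnot group) `(ℝ^N, *)`.
The splitting `ℝ^N = ℝ^{N₁} × ⋯ × ℝ^{N_k}` is encoded by the monotone function `deg`: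
`N_m` is the number of coordinates of degree `m`. The identity is the origin, the only point
fixed by all the dilations. -/
structure StratifiedGroup (N : ℕ) where
  deg : Fin N → ℕ
  deg_pos : ∀ i, 1 ≤ deg i
  deg_mono : Monotone deg
  mul : (Fin N → ℝ) → (Fin N → ℝ) → (Fin N → ℝ)
  inv : (Fin N → ℝ) → (Fin N → ℝ)
  mul_assoc : ∀ x y z, mul (mul x y) z = mul x (mul y z)
  zero_mul : ∀ x, mul 0 x = x
  mul_zero : ∀ x, mul x 0 = x
  inv_mul : ∀ x, mul (inv x) x = 0
  mul_inv : ∀ x, mul x (inv x) = 0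
  contDiff_mul : ContDiff ℝ ∞ (fun p : (Fin N → ℝ) × (Fin N → ℝ) => mul p.1 p.2)
  contDiff_inv : ContDiff ℝ ∞ inv
  /-- The dilations `T_μ(x)ᵢ = μ^{deg i} xᵢ` are automorphisms. -/
  dilation_mul : ∀ μ : ℝ, 0 < μ → ∀ x y : Fin N → ℝ,
    (fun i => μ ^ deg i * mul x y i) =
      mul (fun i => μ ^ deg i * x i) (fun i => μ ^ deg i * y i)
  /-- Hörmander's condition for the fields of the first layer. -/
  hormander : ∀ x : Fin N → ℝ,
    Submodule.span ℝ {v : Fin N → ℝ | ∃ V : (Fin N → ℝ) → (Fin N → ℝ),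
      IterCommutator {W | ∃ i, deg i = 1 ∧ W = leftInvField mul i} V ∧ v = V x} = ⊤

variable {N : ℕ}

/-- Indices of the first layer. -/
abbrev StratifiedGroup.HIdx (G : StratifiedGroup N) : Type := {i : Fin N // G.deg i = 1}

/-- The horizontal vector field `Xᵢ`, acting on functions by `(Xᵢ φ)(x) = dφ(x)[Xᵢ(x)]`. -/
def StratifiedGroup.X (G : StratifiedGroup N) (i : G.HIdx) (φ : (Fin N → ℝ) → ℝ)
    (x : Fin N → ℝ) : ℝ :=
  fderiv ℝ φ x (leftInvField G.mul i.1 x)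

/-- The sub-Laplacian `𝓛 = ∑ᵢ Xᵢ²` on smooth functions. -/
def StratifiedGroup.subLaplacian (G : StratifiedGroup N) (φ : (Fin N → ℝ) → ℝ)
    (x : Fin N → ℝ) : ℝ :=
  ∑ i : G.HIdx, G.X i (G.X i φ) x

/-- `φ ∈ C_c^∞(Ω)`. -/
def IsTest (Ω : Set (Fin N → ℝ)) (φ : (Fin N → ℝ) → ℝ) : Prop :=
  ContDiff ℝ ∞ φ ∧ HasCompactSupport φ ∧ tsupport φ ⊆ Ω

/-- `v` is the weak horizontal gradient of `u` in `Ω`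
(the fields `Xᵢ` are skew-adjoint with respect to Lebesgue measure). -/
def IsWeakHGrad (G : StratifiedGroup N) (Ω : Set (Fin N → ℝ)) (u : (Fin N → ℝ) → ℝ)
    (v : G.HIdx → (Fin N → ℝ) → ℝ) : Prop :=
  LocallyIntegrableOn u Ω ∧ ∀ i, LocallyIntegrableOn (v i) Ω ∧
    ∀ φ, IsTest Ω φ → ∫ x in Ω, u x * G.X i φ x = -∫ x in Ω, v i x * φ x

open Classical in
/-- The weak horizontal gradient of `u` in `Ω` (unique up to a null subset of `Ω`), and `0` if
there is none. -/
def hGrad (G : StratifiedGroup N) (Ω : Set (Fin N → ℝ)) (u : (Fin N → ℝ) → ℝ) :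
    G.HIdx → (Fin N → ℝ) → ℝ :=
  if h : ∃ v, IsWeakHGrad G Ω u v then h.choose else 0

/-- `u ∈ W^{1,2}(Ω)`. -/
def MemW12 (G : StratifiedGroup N) (Ω : Set (Fin N → ℝ)) (u : (Fin N → ℝ) → ℝ) : Prop :=
  MemLp u 2 (volume.restrict Ω) ∧
    ∃ v, IsWeakHGrad G Ω u v ∧ ∀ i, MemLp (v i) 2 (volume.restrict Ω)

/-- `u ∈ W^{1,2}_loc(Ω)`: `u ∈ W^{1,2}(Ω')` for all open `Ω'` compactly contained in `Ω`. -/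
def MemW12Loc (G : StratifiedGroup N) (Ω : Set (Fin N → ℝ)) (u : (Fin N → ℝ) → ℝ) : Prop :=
  ∀ Ω' : Set (Fin N → ℝ), IsOpen Ω' → IsCompact (closure Ω') → closure Ω' ⊆ Ω → MemW12 G Ω' u

/-- The norm `‖u‖_{L²(Ω)} + ‖ |∇_G u| ‖_{L²(Ω)}` of `u ∈ W^{1,2}(Ω)`. -/
def w12Norm (G : StratifiedGroup N) (Ω : Set (Fin N → ℝ)) (u : (Fin N → ℝ) → ℝ) : ℝ :=
  √(∫ x in Ω, u x ^ 2) + √(∫ x in Ω, ∑ i, hGrad G Ω u i x ^ 2)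

/-- `u ∈ W_0^{1,2}(Ω)`: the closure of `C_c^∞(Ω)` in `W^{1,2}(Ω)`. -/
def MemW120 (G : StratifiedGroup N) (Ω : Set (Fin N → ℝ)) (u : (Fin N → ℝ) → ℝ) : Prop :=
  MemW12 G Ω u ∧ ∀ ε : ℝ, 0 < ε → ∃ φ, IsTest Ω φ ∧ w12Norm G Ω (fun x => u x - φ x) < ε

/-- The smooth bump `g : ℝ → [0,2]`, positive exactly on `(0,1)`, with integral one. -/
structure IsBump (g : ℝ → ℝ) : Prop where
  smooth : ContDiff ℝ ∞ g
  mem_Icc : ∀ t, g t ∈ Set.Icc (0 : ℝ) 2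
  zero_left : ∀ t, t ≤ 0 → g t = 0
  pos : ∀ t, 0 < t → t < 1 → 0 < g t
  zero_right : ∀ t, 1 ≤ t → g t = 0
  integral_one : ∫ t in (0 : ℝ)..1, g t = 1

/-- The approximating energy
`I_α(u) = ∫_Ω |∇_G u|²/2 + ∫_Ω 𝒢((u-1)/α) - (λ/3) ∫_Ω (u-1)_+³ f`, where `𝒢(t) = ∫_0^t g`. -/
def energyApprox (G : StratifiedGroup N) (Ω : Set (Fin N → ℝ)) (f : (Fin N → ℝ) → ℝ) (lam : ℝ)
    (g : ℝ → ℝ) (α : ℝ) (u : (Fin N → ℝ) → ℝ) : ℝ :=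
  (∫ x in Ω, (∑ i, hGrad G Ω u i x ^ 2) / 2)
    + (∫ x in Ω, ∫ t in (0 : ℝ)..((u x - 1) / α), g t)
    - lam / 3 * ∫ x in Ω, (max (u x - 1) 0) ^ 3 * f x

/-- `u` is a critical point of `I_α` on `W_0^{1,2}(Ω)`: the derivative of `I_α` at `u` vanishes
in the directions of the dense subspace `C_c^∞(Ω)`. Used for bounded `u`, where `I_α` is finite
and differentiable in those directions whatever the homogeneous dimension of the group. -/
def IsCriticalPoint (G : StratifiedGroup N) (Ω : Set (Fin N → ℝ)) (f : (Fin N → ℝ) → ℝ)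
    (lam : ℝ) (g : ℝ → ℝ) (α : ℝ) (u : (Fin N → ℝ) → ℝ) : Prop :=
  MemW120 G Ω u ∧ ∀ φ, IsTest Ω φ →
    HasDerivAt (fun t : ℝ => energyApprox G Ω f lam g α (fun x => u x + t * φ x)) 0 0

end Stratified

end

/-!
The key fact is Kato's inequality. A bounded critical point `u_j` of `I_{α_j}` solves `𝓛 u_j =
b_j` weakly, where `b_j` (`reaction`) vanishes on `{u_j ≤ 1}`
(`IsCriticalPoint.euler_lagrange`). Hence `𝓛 K(1 - u_j) ≥ 0` for every smooth convex `K` that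
vanishes on `(-∞, 0]` and has bounded derivatives. To see it, the equation is tested with `η
K'(1 - φ)`, where the test function `φ` is close to `u_j` in `W^{1,2}`; such `φ` exist because
`u_j ∈ W₀^{1,2}(Ω)`, so no mollification along the group and no chain rule for weak gradients is
needed (`integral_smoothPosPart_subLaplacian_nonneg`). The inequality only involves `u_j` and
not its gradient, so it survives the uniform limit `j → ∞` and then the limit in which `K` tends
to the positive part: `𝓛 (u - 1)₋ ≥ 0` (`integral_negPart_subLaplacian_nonneg`). A nonnegative
distribution is a Radon measure, by the M. Riesz extension theorem and the Riesz–Markov–Kakutani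
theorem (`exists_regular_measure_of_nonneg`).

The measure is carried by the boundary of `{u < 1}`. On a compact subset of `{u < 1}` the `u_j`
are eventually below `1`, so they are harmonic there and so is `u`
(`integral_negPart_subLaplacian_eq_zero`). In the interior of `{u ≥ 1}` the function `(u - 1)₋`
vanishes.

The Sobolev regularity of `u` follows from weak compactness of the horizontal gradients in `L²`
(`memW12_of_tendstoUniformlyOn`).

Integration by parts rests on the horizontal fields being divergence free. By homogeneity, the
`j`-th derivative of the `j`-th coefficient has degree `-1` under the dilations, and being
continuous at the origin it is zero (`fderiv_leftInvField_diag`).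
-/

noncomputable section

namespace Stratified

variable {N : ℕ}

/-! ### Horizontal fields: homogeneity, vanishing divergence, integration by parts -/

lemma contDiff_leftInvField (G : StratifiedGroup N) (i : Fin N) :
    ContDiff ℝ ∞ (leftInvField G.mul i) := by
  have h : ContDiff ℝ ∞ (fun x => fderiv ℝ (fun y => G.mul x y) 0) :=
    ContDiff.fderiv (f := fun x y => G.mul x y) (g := fun _ => 0) (m := ∞) G.contDiff_mul
      contDiff_const (by simp)
  exact h.clm_apply contDiff_const

/-- The dilation `T_μ` as a continuous linear map. -/
def dilationCLM (G : StratifiedGroup N) (μ : ℝ) : (Fin N → ℝ) →L[ℝ] (Fin N → ℝ) :=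
  ContinuousLinearMap.pi fun i => μ ^ G.deg i • ContinuousLinearMap.proj i

@[simp] lemma dilationCLM_apply (G : StratifiedGroup N) (μ : ℝ) (x : Fin N → ℝ) (i : Fin N) :
    dilationCLM G μ x i = μ ^ G.deg i * x i := by
  simp [dilationCLM]

lemma dilationCLM_single (G : StratifiedGroup N) (μ : ℝ) (j : Fin N) :
    dilationCLM G μ (Pi.single j 1) = μ ^ G.deg j • Pi.single j 1 := by
  ext k
  by_cases h : k = j
  · subst h; simp
  · simp [h]

/-- Horizontal fields are homogeneous of degree one under the dilations. -/
lemma leftInvField_dilation (G : StratifiedGroup N) (i : G.HIdx) {μ : ℝ} (hμ : 0 < μ)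
    (x : Fin N → ℝ) :
    μ • leftInvField G.mul i.1 (dilationCLM G μ x) =
      dilationCLM G μ (leftInvField G.mul i.1 x) := by
  have hd : ∀ z, DifferentiableAt ℝ (fun y => G.mul z y) 0 := fun z =>
    ((G.contDiff_mul.comp (contDiff_prodMk_right z)).differentiable (by simp)).differentiableAt
  have heq : (fun y => G.mul (dilationCLM G μ x) (dilationCLM G μ y)) =
      fun y => dilationCLM G μ (G.mul x y) := by
    funext y
    have h := (G.dilation_mul μ hμ x y).symm
    have e : ∀ z, dilationCLM G μ z = fun i => μ ^ G.deg i * z i := fun z => by ext; simp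
    simpa only [e] using h
  have h1 : HasFDerivAt (fun y => G.mul (dilationCLM G μ x) (dilationCLM G μ y))
      ((fderiv ℝ (fun y => G.mul (dilationCLM G μ x) y) 0).comp (dilationCLM G μ)) 0 := by
    have hh : HasFDerivAt (fun y => G.mul (dilationCLM G μ x) y)
        (fderiv ℝ (fun y => G.mul (dilationCLM G μ x) y) 0) (dilationCLM G μ 0) := by
      rw [map_zero]; exact (hd _).hasFDerivAt
    exact hh.comp 0 (dilationCLM G μ).hasFDerivAt
  have h2 : HasFDerivAt (fun y => dilationCLM G μ (G.mul x y))
      ((dilationCLM G μ).comp (fderiv ℝ (fun y => G.mul x y) 0)) 0 :=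
    (dilationCLM G μ).hasFDerivAt.comp 0 (hd x).hasFDerivAt
  rw [heq] at h1
  have h3 := congrArg (fun L => L (Pi.single i.1 1)) (h1.unique h2)
  simp only [ContinuousLinearMap.comp_apply, dilationCLM_single, i.2, pow_one, map_smul] at h3
  exact h3

/-- Each term of the divergence of a horizontal field vanishes: the `j`-th coefficient is
homogeneous of degree `deg j - 1`, so its `j`-th derivative is continuous and homogeneous of
degree `-1`. -/
lemma fderiv_leftInvField_diag (G : StratifiedGroup N) (i : G.HIdx) (j : Fin N)
    (x : Fin N → ℝ) :
    fderiv ℝ (leftInvField G.mul i.1) x (Pi.single j 1) j = 0 := by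
  set a := leftInvField G.mul i.1 with ha
  have hac : ContDiff ℝ ∞ a := contDiff_leftInvField G i.1
  have had : Differentiable ℝ a := hac.differentiable (by simp)
  have hcont : Continuous fun z => fderiv ℝ a z (Pi.single j 1) j :=
    (continuous_apply j).comp ((hac.continuous_fderiv (by simp)).clm_apply continuous_const)
  have key : ∀ μ : ℝ, 0 < μ →
      μ * fderiv ℝ a (dilationCLM G μ x) (Pi.single j 1) j =
        fderiv ℝ a x (Pi.single j 1) j := by
    intro μ hμ
    have heq : (fun z => μ • a (dilationCLM G μ z)) = fun z => dilationCLM G μ (a z) := by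
      funext z; exact leftInvField_dilation G i hμ z
    have h1 : HasFDerivAt (fun z => μ • a (dilationCLM G μ z))
        (μ • (fderiv ℝ a (dilationCLM G μ x)).comp (dilationCLM G μ)) x :=
      ((had _).hasFDerivAt.comp x (dilationCLM G μ).hasFDerivAt).const_smul μ
    have h2 : HasFDerivAt (fun z => dilationCLM G μ (a z))
        ((dilationCLM G μ).comp (fderiv ℝ a x)) x :=
      (dilationCLM G μ).hasFDerivAt.comp x (had x).hasFDerivAt
    rw [heq] at h1
    have h3 := congrArg (fun L => L (Pi.single j 1) j) (h1.unique h2)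
    simp only [ContinuousLinearMap.comp_apply, _root_.smul_apply,
      dilationCLM_single, map_smul, Pi.smul_apply, smul_eq_mul, dilationCLM_apply] at h3
    have hp : μ ^ G.deg j ≠ 0 := (pow_pos hμ _).ne'
    apply mul_left_cancel₀ hp
    linarith
  have hdil : Tendsto (fun μ : ℝ => dilationCLM G μ x) (𝓝[>] 0) (𝓝 0) := by
    rw [tendsto_pi_nhds]
    intro k
    have hc : Continuous fun μ : ℝ => dilationCLM G μ x k := by
      simp only [dilationCLM_apply]; fun_prop
    have := hc.tendsto 0
    have hk : G.deg k ≠ 0 := Nat.one_le_iff_ne_zero.1 (G.deg_pos k)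
    simp only [dilationCLM_apply, zero_pow hk, zero_mul] at this
    simpa using this.mono_left nhdsWithin_le_nhds
  have hid : Tendsto (fun μ : ℝ => μ) (𝓝[>] 0) (𝓝 0) :=
    (continuous_id.tendsto (0 : ℝ)).mono_left nhdsWithin_le_nhds
  have hlim := hid.mul ((hcont.tendsto 0).comp hdil)
  rw [zero_mul] at hlim
  have hconst : Tendsto (fun _ : ℝ => fderiv ℝ a x (Pi.single j 1) j) (𝓝[>] 0) (𝓝 0) := by
    refine hlim.congr' ?_
    filter_upwards [self_mem_nhdsWithin] with μ hμ
    exact key μ hμ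
  exact tendsto_nhds_unique tendsto_const_nhds hconst

lemma contDiff_X (G : StratifiedGroup N) (i : G.HIdx) {φ : (Fin N → ℝ) → ℝ}
    (hφ : ContDiff ℝ ∞ φ) : ContDiff ℝ ∞ (G.X i φ) :=
  (hφ.fderiv_right (m := ∞) (by simp)).clm_apply (contDiff_leftInvField G i.1)

lemma tsupport_X_subset (G : StratifiedGroup N) (i : G.HIdx) (φ : (Fin N → ℝ) → ℝ) :
    tsupport (G.X i φ) ⊆ tsupport φ := by
  refine closure_minimal (fun x hx => ?_) (isClosed_tsupport φ)
  by_contra h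
  have h0 : fderiv ℝ φ x = 0 := by
    have := mt (fun hh => tsupport_fderiv_subset ℝ (f := φ) hh) h
    exact image_eq_zero_of_notMem_tsupport this
  exact hx (by simp [StratifiedGroup.X, h0])

lemma X_mul (G : StratifiedGroup N) (i : G.HIdx) {φ ψ : (Fin N → ℝ) → ℝ} {x : Fin N → ℝ}
    (hφ : DifferentiableAt ℝ φ x) (hψ : DifferentiableAt ℝ ψ x) :
    G.X i (fun y => φ y * ψ y) x = φ x * G.X i ψ x + ψ x * G.X i φ x := by
  simp [StratifiedGroup.X, fderiv_fun_mul hφ hψ]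

lemma X_add (G : StratifiedGroup N) (i : G.HIdx) {φ ψ : (Fin N → ℝ) → ℝ} {x : Fin N → ℝ}
    (hφ : DifferentiableAt ℝ φ x) (hψ : DifferentiableAt ℝ ψ x) :
    G.X i (fun y => φ y + ψ y) x = G.X i φ x + G.X i ψ x := by
  simp [StratifiedGroup.X, fderiv_fun_add hφ hψ]

lemma X_const_mul (G : StratifiedGroup N) (i : G.HIdx) (c : ℝ) {φ : (Fin N → ℝ) → ℝ}
    {x : Fin N → ℝ} (hφ : DifferentiableAt ℝ φ x) :
    G.X i (fun y => c * φ y) x = c * G.X i φ x := by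
  simp [StratifiedGroup.X, fderiv_const_mul hφ]

lemma X_comp_one_sub (G : StratifiedGroup N) (i : G.HIdx) {φ : (Fin N → ℝ) → ℝ}
    {x : Fin N → ℝ} {H : ℝ → ℝ} {H' : ℝ} (hφ : DifferentiableAt ℝ φ x)
    (hH : HasDerivAt H H' (1 - φ x)) :
    G.X i (fun y => H (1 - φ y)) x = -(H' * G.X i φ x) := by
  have h := (hH.comp_hasFDerivAt x (hφ.hasFDerivAt.const_sub 1)).fderiv
  simp only [StratifiedGroup.X]
  have e : (fun y => H (1 - φ y)) = H ∘ fun y => 1 - φ y := rfl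
  rw [e, h]
  simp

/-- Horizontal derivatives of compactly supported functions have mean zero, that is, Lebesgue
measure is invariant under the flows of the horizontal fields. -/
lemma integral_X_eq_zero (G : StratifiedGroup N) (i : G.HIdx) {φ : (Fin N → ℝ) → ℝ}
    (hφ : ContDiff ℝ ∞ φ) (hc : HasCompactSupport φ) : ∫ x, G.X i φ x = 0 := by
  set a := leftInvField G.mul i.1 with ha
  have hac : ContDiff ℝ ∞ a := contDiff_leftInvField G i.1
  have haj : ∀ j, ContDiff ℝ ∞ fun x => a x j := fun j => contDiff_pi.1 hac j
  have hφd : ∀ j, Continuous fun x => fderiv ℝ φ x (Pi.single j 1) := fun j =>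
    (hφ.continuous_fderiv (by simp)).clm_apply continuous_const
  have hφdc : ∀ j, HasCompactSupport fun x => fderiv ℝ φ x (Pi.single j 1) := fun j =>
    hc.fderiv_apply ℝ (Pi.single j 1)
  have hexp : ∀ x, G.X i φ x = ∑ j, a x j * fderiv ℝ φ x (Pi.single j 1) := by
    intro x
    simp only [StratifiedGroup.X]
    rw [← ha]
    conv_lhs => rw [pi_eq_sum_univ' (a x)]
    simp [map_sum]
  have hint : ∀ j, Integrable fun x => a x j * fderiv ℝ φ x (Pi.single j 1) := fun j =>
    ((haj j).continuous.mul (hφd j)).integrable_of_hasCompactSupport (hφdc j).mul_left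
  simp_rw [hexp]
  rw [integral_finsetSum _ fun j _ => hint j]
  refine Finset.sum_eq_zero fun j _ => ?_
  have hdj : ∀ x, fderiv ℝ (fun x => a x j) x (Pi.single j 1) = 0 := by
    intro x
    have h := fderiv_leftInvField_diag G i j x
    rw [← ha] at h
    rw [← h, fderiv_apply (hac.differentiable (by simp)).differentiableAt j]
    simp
  rw [integral_mul_fderiv_eq_neg_fderiv_mul_of_integrable]
  · simp [hdj]
  · simp [hdj]
  · exact hint j
  · exact ((haj j).continuous.mul hφ.continuous).integrable_of_hasCompactSupport hc.mul_left
  · exact fun x _ => ((haj j).differentiable (by simp)).differentiableAt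
  · exact fun x _ => (hφ.differentiable (by simp)).differentiableAt

lemma integral_mul_X (G : StratifiedGroup N) (i : G.HIdx) {φ ψ : (Fin N → ℝ) → ℝ}
    (hφ : ContDiff ℝ ∞ φ) (hψ : ContDiff ℝ ∞ ψ) (hc : HasCompactSupport ψ) :
    ∫ x, φ x * G.X i ψ x = -∫ x, G.X i φ x * ψ x := by
  have h := integral_X_eq_zero G i (hφ.mul hψ) hc.mul_left
  have e : ∀ x, G.X i (fun y => φ y * ψ y) x = φ x * G.X i ψ x + G.X i φ x * ψ x := by
    intro x
    rw [X_mul G i (hφ.differentiable (by simp)).differentiableAt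
      (hψ.differentiable (by simp)).differentiableAt]
    ring
  have hXc : HasCompactSupport (G.X i ψ) :=
    hc.of_isClosed_subset (isClosed_tsupport _) (tsupport_X_subset G i ψ)
  simp_rw [e] at h
  rw [integral_add] at h
  · linarith
  · exact (hφ.continuous.mul (contDiff_X G i hψ).continuous).integrable_of_hasCompactSupport
      hXc.mul_left
  · exact ((contDiff_X G i hφ).continuous.mul hψ.continuous).integrable_of_hasCompactSupport
      hc.mul_left

/-! ### Test functions -/

section Test

variable {Ω : Set (Fin N → ℝ)} {φ ψ : (Fin N → ℝ) → ℝ}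

lemma IsTest.mono {Ω' : Set (Fin N → ℝ)} (h : IsTest Ω φ) (hΩ : Ω ⊆ Ω') : IsTest Ω' φ :=
  ⟨h.1, h.2.1, h.2.2.trans hΩ⟩

lemma IsTest.differentiable (h : IsTest Ω φ) : Differentiable ℝ φ :=
  h.1.differentiable (by simp)

lemma IsTest.eq_zero (h : IsTest Ω φ) {x : Fin N → ℝ} (hx : x ∉ Ω) : φ x = 0 :=
  image_eq_zero_of_notMem_tsupport fun hh => hx (h.2.2 hh)

lemma IsTest.of_tsupport_subset (h : IsTest Ω φ) (hψ : ContDiff ℝ ∞ ψ)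
    (hs : tsupport ψ ⊆ tsupport φ) : IsTest Ω ψ :=
  ⟨hψ, h.2.1.of_isClosed_subset (isClosed_tsupport _) hs, hs.trans h.2.2⟩

lemma isTest_zero : IsTest Ω (fun _ => 0) :=
  ⟨contDiff_const, HasCompactSupport.zero, by simp [tsupport]⟩

lemma IsTest.add (hφ : IsTest Ω φ) (hψ : IsTest Ω ψ) : IsTest Ω (fun x => φ x + ψ x) :=
  ⟨hφ.1.add hψ.1, hφ.2.1.add hψ.2.1,
    (tsupport_add φ ψ).trans (Set.union_subset hφ.2.2 hψ.2.2)⟩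

lemma IsTest.mul_right (hφ : IsTest Ω φ) (hψ : ContDiff ℝ ∞ ψ) :
    IsTest Ω (fun x => φ x * ψ x) :=
  hφ.of_tsupport_subset (hφ.1.mul hψ) (tsupport_mul_subset_left (f := φ) (g := ψ))

lemma IsTest.const_mul (hφ : IsTest Ω φ) (c : ℝ) : IsTest Ω (fun x => c * φ x) :=
  hφ.of_tsupport_subset (contDiff_const.mul hφ.1)
    (tsupport_mul_subset_right (f := fun _ => c) (g := φ))

lemma IsTest.X (G : StratifiedGroup N) (i : G.HIdx) (hφ : IsTest Ω φ) : IsTest Ω (G.X i φ) :=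
  hφ.of_tsupport_subset (contDiff_X G i hφ.1) (tsupport_X_subset G i φ)

lemma IsTest.subLaplacian (G : StratifiedGroup N) (hφ : IsTest Ω φ) :
    IsTest Ω (G.subLaplacian φ) := by
  have h : ∀ s : Finset G.HIdx, IsTest Ω (fun x => ∑ i ∈ s, G.X i (G.X i φ) x) := by
    classical
    intro s
    induction s using Finset.induction_on with
    | empty => simpa using isTest_zero
    | insert a s has ih =>
      simp only [Finset.sum_insert has]
      exact ((hφ.X G a).X G a).add ih
  exact h Finset.univ

lemma IsTest.exists_bound (hφ : IsTest Ω φ) : ∃ C, ∀ x, |φ x| ≤ C := by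
  simpa only [Real.norm_eq_abs] using hφ.1.continuous.bounded_above_of_compact_support hφ.2.1

lemma IsTest.integrable (hφ : IsTest Ω φ) (μ : Measure (Fin N → ℝ))
    [IsFiniteMeasureOnCompacts μ] : Integrable φ μ :=
  hφ.1.continuous.integrable_of_hasCompactSupport hφ.2.1

lemma IsTest.memLp (hφ : IsTest Ω φ) (p : ENNReal) (μ : Measure (Fin N → ℝ))
    [IsFiniteMeasureOnCompacts μ] : MemLp φ p μ :=
  hφ.1.continuous.memLp_of_hasCompactSupport hφ.2.1

lemma IsTest.setIntegral (hφ : IsTest Ω φ) : ∫ x in Ω, φ x = ∫ x, φ x :=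
  setIntegral_eq_integral_of_forall_compl_eq_zero fun _ hx => hφ.eq_zero hx

lemma subLaplacian_add (G : StratifiedGroup N) (hφ : IsTest Ω φ) (hψ : IsTest Ω ψ)
    (x : Fin N → ℝ) :
    G.subLaplacian (fun y => φ y + ψ y) x = G.subLaplacian φ x + G.subLaplacian ψ x := by
  have e : ∀ i, G.X i (fun y => φ y + ψ y) = fun y => G.X i φ y + G.X i ψ y := fun i => by
    funext y; exact X_add G i (hφ.differentiable y) (hψ.differentiable y)
  simp only [StratifiedGroup.subLaplacian, e]
  rw [← Finset.sum_add_distrib]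
  exact Finset.sum_congr rfl fun i _ =>
    X_add G i ((hφ.X G i).differentiable x) ((hψ.X G i).differentiable x)

lemma subLaplacian_const_mul (G : StratifiedGroup N) (c : ℝ) (hφ : IsTest Ω φ)
    (x : Fin N → ℝ) :
    G.subLaplacian (fun y => c * φ y) x = c * G.subLaplacian φ x := by
  have e : ∀ i, G.X i (fun y => c * φ y) = fun y => c * G.X i φ y := fun i => by
    funext y; exact X_const_mul G i c (hφ.differentiable y)
  simp only [StratifiedGroup.subLaplacian, e]
  rw [Finset.mul_sum]
  exact Finset.sum_congr rfl fun i _ => X_const_mul G i c ((hφ.X G i).differentiable x)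

/-- Green's formula for a smooth function and a test function. -/
lemma integral_mul_subLaplacian (G : StratifiedGroup N) (hφ : ContDiff ℝ ∞ φ)
    (hψ : IsTest Ω ψ) :
    ∫ x in Ω, φ x * G.subLaplacian ψ x = -∫ x in Ω, ∑ i, G.X i φ x * G.X i ψ x := by
  have h1 : ∀ i, IsTest Ω (fun x => φ x * G.X i (G.X i ψ) x) := fun i => by
    simpa only [mul_comm] using ((hψ.X G i).X G i).mul_right hφ
  have h2 : ∀ i, IsTest Ω (fun x => G.X i φ x * G.X i ψ x) := fun i => by
    simpa only [mul_comm] using (hψ.X G i).mul_right (contDiff_X G i hφ)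
  simp only [StratifiedGroup.subLaplacian, Finset.mul_sum]
  rw [integral_finsetSum _ fun i _ => (h1 i).integrable _,
    integral_finsetSum _ fun i _ => (h2 i).integrable _, ← Finset.sum_neg_distrib]
  refine Finset.sum_congr rfl fun i _ => ?_
  rw [(h1 i).setIntegral, (h2 i).setIntegral]
  exact integral_mul_X G i hφ (hψ.X G i).1 (hψ.X G i).2.1

lemma integral_subLaplacian (G : StratifiedGroup N) (hψ : IsTest Ω ψ) :
    ∫ x in Ω, G.subLaplacian ψ x = 0 := by
  have h := integral_mul_subLaplacian G (φ := fun _ => (1 : ℝ)) contDiff_const hψ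
  simpa [StratifiedGroup.X] using h

end Test

/-! ### Weak horizontal gradients -/

section WeakGradient

variable {G : StratifiedGroup N} {Ω : Set (Fin N → ℝ)} {u φ : (Fin N → ℝ) → ℝ}
  {v w : G.HIdx → (Fin N → ℝ) → ℝ}

lemma IsTest.integrable_mul_of_locallyIntegrableOn (hφ : IsTest Ω φ)
    (hu : LocallyIntegrableOn u Ω) : Integrable fun x => u x * φ x := by
  obtain ⟨C, hC⟩ := hφ.exists_bound
  have h1 : IntegrableOn u (tsupport φ) := hu.integrableOn_compact_subset hφ.2.2 hφ.2.1
  have h2 : IntegrableOn (fun x => u x * φ x) (tsupport φ) :=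
    Integrable.mul_bdd (c := C) h1 hφ.1.continuous.aestronglyMeasurable
      (Eventually.of_forall fun x => by simpa using hC x)
  refine (integrableOn_iff_integrable_of_support_subset fun x hx => ?_).1 h2
  exact subset_tsupport _ (right_ne_zero_of_mul hx)

lemma IsWeakHGrad.ae_eq (hΩ : IsOpen Ω) (hv : IsWeakHGrad G Ω u v) (hw : IsWeakHGrad G Ω u w)
    (i : G.HIdx) : v i =ᵐ[volume.restrict Ω] w i := by
  have h := hΩ.ae_eq_zero_of_integral_contDiff_smul_eq_zero (μ := volume)
    (f := fun x => v i x - w i x) ((hv.2 i).1.sub (hw.2 i).1) (fun φ h1 h2 h3 => by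
      have ht : IsTest Ω φ := ⟨h1, h2, h3⟩
      have e : ∀ z : G.HIdx → (Fin N → ℝ) → ℝ,
          ∫ x in Ω, z i x * φ x = ∫ x, z i x * φ x := fun z =>
        setIntegral_eq_integral_of_forall_compl_eq_zero fun x hx => by simp [ht.eq_zero hx]
      have h4 := (hv.2 i).2 φ ht
      rw [(hw.2 i).2 φ ht, e, e, neg_inj] at h4
      have e2 : ∀ x, φ x • (v i x - w i x) = v i x * φ x - w i x * φ x := fun x => by
        simp only [smul_eq_mul]; ring
      simp_rw [e2]
      rw [integral_sub (ht.integrable_mul_of_locallyIntegrableOn (hv.2 i).1)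
        (ht.integrable_mul_of_locallyIntegrableOn (hw.2 i).1), h4, sub_self])
  rw [EventuallyEq, ae_restrict_iff' hΩ.measurableSet]
  filter_upwards [h] with x hx hxΩ
  exact sub_eq_zero.1 (hx hxΩ)

lemma IsWeakHGrad.hGrad (h : IsWeakHGrad G Ω u v) : IsWeakHGrad G Ω u (hGrad G Ω u) := by
  have hex : ∃ v, IsWeakHGrad G Ω u v := ⟨v, h⟩
  rw [Stratified.hGrad, dif_pos hex]
  exact hex.choose_spec

lemma IsWeakHGrad.hGrad_ae_eq (hΩ : IsOpen Ω) (h : IsWeakHGrad G Ω u v) (i : G.HIdx) :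
    Stratified.hGrad G Ω u i =ᵐ[volume.restrict Ω] v i :=
  h.hGrad.ae_eq hΩ h i

lemma MemW12.isWeakHGrad (h : MemW12 G Ω u) : IsWeakHGrad G Ω u (hGrad G Ω u) := by
  obtain ⟨-, v, hv, -⟩ := h
  exact hv.hGrad

lemma MemW12.memLp_hGrad (hΩ : IsOpen Ω) (h : MemW12 G Ω u) (i : G.HIdx) :
    MemLp (hGrad G Ω u i) 2 (volume.restrict Ω) := by
  obtain ⟨-, v, hv, hv2⟩ := h
  exact (memLp_congr_ae (hv.hGrad_ae_eq hΩ i)).2 (hv2 i)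

/-- Adding a multiple of a test function adds the multiple of its classical horizontal
gradient. -/
lemma IsWeakHGrad.add_const_mul_test (hv : IsWeakHGrad G Ω u v) (hφ : IsTest Ω φ) (t : ℝ) :
    IsWeakHGrad G Ω (fun x => u x + t * φ x) (fun i x => v i x + t * G.X i φ x) := by
  refine ⟨hv.1.add
      (((hφ.const_mul t).integrable volume).locallyIntegrable.locallyIntegrableOn _),
    fun i => ⟨(hv.2 i).1.add
      ((((hφ.X G i).const_mul t).integrable volume).locallyIntegrable.locallyIntegrableOn _),
      fun ψ hψ => ?_⟩⟩
  have h1 := ((hψ.X G i).integrable_mul_of_locallyIntegrableOn hv.1).integrableOn (s := Ω)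
  have h2 := (hψ.integrable_mul_of_locallyIntegrableOn (hv.2 i).1).integrableOn (s := Ω)
  have t1 : IsTest Ω fun x => φ x * G.X i ψ x := hφ.mul_right (contDiff_X G i hψ.1)
  have t2 : IsTest Ω fun x => G.X i φ x * ψ x := (hφ.X G i).mul_right hψ.1
  have e1 : ∀ x, (u x + t * φ x) * G.X i ψ x = u x * G.X i ψ x + t * (φ x * G.X i ψ x) :=
    fun x => by ring
  have e2 : ∀ x, (v i x + t * G.X i φ x) * ψ x = v i x * ψ x + t * (G.X i φ x * ψ x) :=
    fun x => by ring
  simp_rw [e1, e2]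
  rw [integral_add h1 ((t1.integrable _).const_mul t),
    integral_add h2 ((t2.integrable _).const_mul t), integral_const_mul, integral_const_mul,
    (hv.2 i).2 ψ hψ, t1.setIntegral, t2.setIntegral, integral_mul_X G i hφ.1 hψ.1 hψ.2.1]
  ring

end WeakGradient

/-! ### The Euler–Lagrange equation -/

lemma hasDerivAt_max_zero_cube (s : ℝ) :
    HasDerivAt (fun s : ℝ => max s 0 ^ 3) (3 * max s 0 ^ 2) s := by
  rcases lt_trichotomy s 0 with h | rfl | h
  · have e : (fun s : ℝ => max s 0 ^ 3) =ᶠ[𝓝 s] fun _ => 0 := by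
      filter_upwards [eventually_lt_nhds h] with y hy
      simp [max_eq_right hy.le]
    simpa [max_eq_right h.le] using (hasDerivAt_const s (0 : ℝ)).congr_of_eventuallyEq e
  · -- at the origin compare with `s³`, which vanishes to second order
    have hc : HasDerivAt (fun s : ℝ => s ^ 3) 0 0 := by simpa using hasDerivAt_pow 3 (0 : ℝ)
    rw [hasDerivAt_iff_isLittleO] at hc ⊢
    refine Asymptotics.IsBigO.trans_isLittleO ?_ hc
    refine Asymptotics.IsBigO.of_bound 1 (Eventually.of_forall fun y => ?_)
    rcases le_total y 0 with hy | hy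
    · simp [max_eq_right hy]
    · simp [max_eq_left hy]
  · have e : (fun s : ℝ => max s 0 ^ 3) =ᶠ[𝓝 s] fun s => s ^ 3 := by
      filter_upwards [eventually_gt_nhds h] with y hy
      simp [max_eq_left hy.le]
    simpa [max_eq_left h.le] using (hasDerivAt_pow 3 s).congr_of_eventuallyEq e

section Bump

variable {g : ℝ → ℝ}

lemma IsBump.abs_le (hg : IsBump g) (t : ℝ) : |g t| ≤ 2 := by
  rw [abs_of_nonneg (hg.mem_Icc t).1]; exact (hg.mem_Icc t).2

lemma IsBump.hasDerivAt_primitive (hg : IsBump g) (s : ℝ) :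
    HasDerivAt (fun s => ∫ t in (0 : ℝ)..s, g t) (g s) s :=
  intervalIntegral.integral_hasDerivAt_right (hg.smooth.continuous.intervalIntegrable _ _)
    (hg.smooth.continuous.stronglyMeasurableAtFilter _ _) hg.smooth.continuous.continuousAt

lemma IsBump.continuous_primitive (hg : IsBump g) :
    Continuous fun s : ℝ => ∫ t in (0 : ℝ)..s, g t :=
  continuous_iff_continuousAt.2 fun s => (hg.hasDerivAt_primitive s).continuousAt

lemma IsBump.abs_primitive_le (hg : IsBump g) (s : ℝ) :
    |∫ t in (0 : ℝ)..s, g t| ≤ 2 * |s| := by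
  have := intervalIntegral.norm_integral_le_of_norm_le_const (a := 0) (b := s) (f := g) (C := 2)
    fun t _ => by simpa using hg.abs_le t
  simpa using this

end Bump

lemma exists_ae_abs_le_of_memLp_top {X : Type*} [MeasurableSpace X] {μ : Measure X} {f : X → ℝ}
    (hf : MemLp f ⊤ μ) : ∃ C, 0 ≤ C ∧ ∀ᵐ x ∂μ, |f x| ≤ C := by
  refine ⟨(eLpNorm f ⊤ μ).toReal, ENNReal.toReal_nonneg, ?_⟩
  have h := ae_le_eLpNormEssSup (f := f) (μ := μ)
  filter_upwards [h] with x hx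
  rw [← eLpNorm_exponent_top] at hx
  have := ENNReal.toReal_mono hf.2.ne hx
  simpa using this

/-- The zeroth order term of the Euler–Lagrange equation of `I_α`: critical points `u` satisfy
`𝓛 u = reaction u` in the weak sense. -/
def reaction (f : (Fin N → ℝ) → ℝ) (lam : ℝ) (g : ℝ → ℝ) (α : ℝ) (u : (Fin N → ℝ) → ℝ)
    (x : Fin N → ℝ) : ℝ :=
  g ((u x - 1) / α) / α - lam * (max (u x - 1) 0 ^ 2 * f x)

section EulerLagrange

variable {G : StratifiedGroup N} {Ω : Set (Fin N → ℝ)} {u φ f : (Fin N → ℝ) → ℝ}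
  {lam α : ℝ} {g : ℝ → ℝ}

lemma reaction_eq_zero (hg : IsBump g) (hα : 0 < α) {x : Fin N → ℝ} (hx : u x ≤ 1) :
    reaction f lam g α u x = 0 := by
  have h1 : (u x - 1) / α ≤ 0 := div_nonpos_of_nonpos_of_nonneg (by linarith) hα.le
  simp [reaction, hg.zero_left _ h1, max_eq_right (sub_nonpos.2 hx)]

lemma hasDerivAt_dirichlet (hΩ : IsOpen Ω) (hu : MemW12 G Ω u) (hφ : IsTest Ω φ) :
    HasDerivAt (fun t : ℝ =>
        ∫ x in Ω, (∑ i, hGrad G Ω (fun x => u x + t * φ x) i x ^ 2) / 2)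
      (∫ x in Ω, ∑ i, hGrad G Ω u i x * G.X i φ x) 0 := by
  set v := hGrad G Ω u with hv
  have hv2 : ∀ i, MemLp (v i) 2 (volume.restrict Ω) := hu.memLp_hGrad hΩ
  have hX2 : ∀ i, MemLp (G.X i φ) 2 (volume.restrict Ω) := fun i => (hφ.X G i).memLp 2 _
  have i1 : Integrable (fun x => ∑ i, v i x ^ 2) (volume.restrict Ω) :=
    integrable_finsetSum _ fun i _ => (hv2 i).integrable_sq
  have i2 : Integrable (fun x => ∑ i, v i x * G.X i φ x) (volume.restrict Ω) :=
    integrable_finsetSum _ fun i _ => (hv2 i).integrable_mul (hX2 i)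
  have i3 : Integrable (fun x => ∑ i, G.X i φ x ^ 2) (volume.restrict Ω) :=
    integrable_finsetSum _ fun i _ => (hX2 i).integrable_sq
  have key : ∀ t : ℝ, ∫ x in Ω, (∑ i, hGrad G Ω (fun x => u x + t * φ x) i x ^ 2) / 2 =
      (∫ x in Ω, ∑ i, v i x ^ 2) / 2 + t * (∫ x in Ω, ∑ i, v i x * G.X i φ x)
        + t ^ 2 * ((∫ x in Ω, ∑ i, G.X i φ x ^ 2) / 2) := by
    intro t
    have hae : ∀ᵐ x ∂volume.restrict Ω, ∀ i,
        hGrad G Ω (fun x => u x + t * φ x) i x = v i x + t * G.X i φ x :=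
      ae_all_iff.2 fun i => (hu.isWeakHGrad.add_const_mul_test hφ t).hGrad_ae_eq hΩ i
    have h1 : ∫ x in Ω, (∑ i, hGrad G Ω (fun x => u x + t * φ x) i x ^ 2) / 2 =
        ∫ x in Ω, ((∑ i, v i x ^ 2) / 2 + t * (∑ i, v i x * G.X i φ x)
          + t ^ 2 * ((∑ i, G.X i φ x ^ 2) / 2)) := by
      refine integral_congr_ae ?_
      filter_upwards [hae] with x hx
      simp only [hx, Finset.sum_div, Finset.mul_sum, ← Finset.sum_add_distrib]
      exact Finset.sum_congr rfl fun i _ => by ring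
    have h2 : Integrable (fun x => (∑ i, v i x ^ 2) / 2 + t * ∑ i, v i x * G.X i φ x)
        (volume.restrict Ω) := (i1.div_const 2).add (i2.const_mul t)
    rw [h1, integral_add h2 ((i3.div_const 2).const_mul _),
      integral_add (i1.div_const 2) (i2.const_mul t), integral_const_mul, integral_const_mul,
      integral_div, integral_div]
  simp_rw [key]
  have h := (((hasDerivAt_id (0 : ℝ)).mul_const (∫ x in Ω, ∑ i, v i x * G.X i φ x)).const_add
    ((∫ x in Ω, ∑ i, v i x ^ 2) / 2)).add
    ((hasDerivAt_pow 2 (0 : ℝ)).mul_const ((∫ x in Ω, ∑ i, G.X i φ x ^ 2) / 2))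
  exact h.congr_deriv (by simp)

lemma hasDerivAt_bump_energy [IsFiniteMeasure (volume.restrict Ω)] (hg : IsBump g)
    (hu : MemLp u 2 (volume.restrict Ω)) (hφ : IsTest Ω φ) :
    Integrable (fun x => g ((u x - 1) / α) / α * φ x) (volume.restrict Ω) ∧
    HasDerivAt (fun t : ℝ => ∫ x in Ω, ∫ s in (0 : ℝ)..((u x + t * φ x - 1) / α), g s)
      (∫ x in Ω, g ((u x - 1) / α) / α * φ x) 0 := by
  have hum := hu.1
  have hφm : AEStronglyMeasurable φ (volume.restrict Ω) := hφ.1.continuous.aestronglyMeasurable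
  have harg : ∀ t : ℝ, AEStronglyMeasurable (fun x => (u x + t * φ x - 1) / α)
      (volume.restrict Ω) := fun t =>
    ((hum.add (hφm.const_mul t)).sub aestronglyMeasurable_const).div₀ aestronglyMeasurable_const
  have h := hasDerivAt_integral_of_dominated_loc_of_deriv_le (μ := volume.restrict Ω)
    (F := fun t x => ∫ s in (0 : ℝ)..((u x + t * φ x - 1) / α), g s)
    (F' := fun t x => g ((u x + t * φ x - 1) / α) / α * φ x) (x₀ := (0 : ℝ)) (s := Set.univ)
    (bound := fun x => 2 / |α| * |φ x|) univ_mem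
    (Eventually.of_forall fun t => hg.continuous_primitive.comp_aestronglyMeasurable (harg t))
    ?_ ?_ ?_ ?_ ?_
  · simpa using h
  · have hi : Integrable (fun x => 2 * |(u x + 0 * φ x - 1) / α|) (volume.restrict Ω) := by
      have h1 : Integrable (fun x => (u x - 1) / α) (volume.restrict Ω) :=
        ((hu.integrable (by norm_num)).sub (integrable_const _)).div_const α
      simpa using h1.abs.const_mul 2
    exact hi.mono' (hg.continuous_primitive.comp_aestronglyMeasurable (harg 0))
      (Eventually.of_forall fun x => hg.abs_primitive_le _)
  · exact ((hg.smooth.continuous.comp_aestronglyMeasurable (harg 0)).div₀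
      aestronglyMeasurable_const).mul hφm
  · refine Eventually.of_forall fun x t _ => ?_
    rw [Real.norm_eq_abs, abs_mul, abs_div]
    have := hg.abs_le ((u x + t * φ x - 1) / α)
    gcongr
  · exact (hφ.integrable (volume.restrict Ω)).abs.const_mul _
  · refine Eventually.of_forall fun x t _ => ?_
    have h1 : HasDerivAt (fun t : ℝ => (u x + t * φ x - 1) / α) (φ x / α) t := by
      simpa using (((hasDerivAt_id t).mul_const (φ x)).const_add (u x)).sub_const 1 |>.div_const α
    exact ((hg.hasDerivAt_primitive _).comp t h1).congr_deriv (by ring)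

lemma hasDerivAt_cubic_energy [IsFiniteMeasure (volume.restrict Ω)]
    (hu : MemLp u 2 (volume.restrict Ω)) (hub : ∃ C, ∀ᵐ x ∂volume.restrict Ω, |u x| ≤ C)
    (hf : MemLp f ⊤ (volume.restrict Ω)) (hφ : IsTest Ω φ) :
    Integrable (fun x => max (u x - 1) 0 ^ 2 * f x * φ x) (volume.restrict Ω) ∧
    HasDerivAt (fun t : ℝ => ∫ x in Ω, max (u x + t * φ x - 1) 0 ^ 3 * f x)
      (3 * ∫ x in Ω, max (u x - 1) 0 ^ 2 * f x * φ x) 0 := by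
  obtain ⟨C, hC⟩ := hub
  obtain ⟨Cf, hCf0, hCf⟩ := exists_ae_abs_le_of_memLp_top hf
  obtain ⟨Cφ, hCφ⟩ := hφ.exists_bound
  have hum := hu.1
  have hφm : AEStronglyMeasurable φ (volume.restrict Ω) := hφ.1.continuous.aestronglyMeasurable
  have hmax : ∀ t : ℝ, AEStronglyMeasurable (fun x => max (u x + t * φ x - 1) 0)
      (volume.restrict Ω) := fun t =>
    (continuous_id.max continuous_const).comp_aestronglyMeasurable
      ((hum.add (hφm.const_mul t)).sub aestronglyMeasurable_const)
  have hmb : ∀ x t, |u x| ≤ C → t ∈ Set.Icc (-1 : ℝ) 1 →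
      |max (u x + t * φ x - 1) 0| ≤ C + Cφ + 1 := by
    intro x t hx ht
    have h1 : |t * φ x| ≤ Cφ := by
      rw [abs_mul]
      calc |t| * |φ x| ≤ 1 * |φ x| := by gcongr; exact abs_le.2 ht
        _ ≤ Cφ := by simpa using hCφ x
    have h2 := (abs_nonneg _).trans hx
    have h3 := (abs_nonneg _).trans h1
    rw [abs_of_nonneg (le_max_right _ _)]
    refine max_le ?_ (by linarith)
    linarith [le_abs_self (u x), le_abs_self (t * φ x)]
  have h := hasDerivAt_integral_of_dominated_loc_of_deriv_le (μ := volume.restrict Ω)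
    (F := fun t x => max (u x + t * φ x - 1) 0 ^ 3 * f x)
    (F' := fun t x => 3 * (max (u x + t * φ x - 1) 0 ^ 2 * f x * φ x)) (x₀ := (0 : ℝ))
    (s := Set.Icc (-1 : ℝ) 1)
    (bound := fun x => 3 * ((C + Cφ + 1) ^ 2 * Cf * |φ x|))
    (Icc_mem_nhds (by norm_num) (by norm_num))
    (Eventually.of_forall fun t => ((hmax t).pow 3).mul hf.1)
    ?_ ?_ ?_ ?_ ?_
  · refine ⟨?_, ?_⟩
    · simpa using h.1.div_const 3
    · simpa [integral_const_mul] using h.2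
  · refine Integrable.of_bound (C := (C + Cφ + 1) ^ 3 * Cf) (((hmax 0).pow 3).mul hf.1) ?_
    filter_upwards [hC, hCf] with x h1 h2
    rw [Real.norm_eq_abs, abs_mul, abs_pow]
    have := hmb x 0 h1 (by norm_num)
    have := (abs_nonneg _).trans this
    gcongr
  · exact ((((hmax 0).pow 2).mul hf.1).mul hφm).const_mul 3
  · filter_upwards [hC, hCf] with x h1 h2 t ht
    rw [Real.norm_eq_abs, abs_mul, abs_mul, abs_mul, abs_pow, abs_of_pos (by norm_num : (0:ℝ) < 3)]
    have := hmb x t h1 ht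
    gcongr
  · exact ((hφ.integrable (volume.restrict Ω)).abs.const_mul _).const_mul 3
  · refine Eventually.of_forall fun x t _ => ?_
    have h1 : HasDerivAt (fun t : ℝ => u x + t * φ x - 1) (φ x) t := by
      simpa using (((hasDerivAt_id t).mul_const (φ x)).const_add (u x)).sub_const 1
    exact (((hasDerivAt_max_zero_cube _).comp t h1).mul_const (f x)).congr_deriv (by ring)

/-- The weak Euler–Lagrange equation of bounded critical points of `I_α`. -/
lemma IsCriticalPoint.euler_lagrange [IsFiniteMeasure (volume.restrict Ω)] (hΩ : IsOpen Ω)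
    (hg : IsBump g) (hcrit : IsCriticalPoint G Ω f lam g α u)
    (hub : ∃ C, ∀ᵐ x ∂volume.restrict Ω, |u x| ≤ C)
    (hf : MemLp f ⊤ (volume.restrict Ω)) (hφ : IsTest Ω φ) :
    (∫ x in Ω, ∑ i, hGrad G Ω u i x * G.X i φ x)
      + ∫ x in Ω, reaction f lam g α u x * φ x = 0 := by
  have hu := hcrit.1.1
  have h1 := hasDerivAt_dirichlet hΩ hu hφ
  obtain ⟨i2, h2⟩ := hasDerivAt_bump_energy (α := α) hg hu.1 hφ
  obtain ⟨i3, h3⟩ := hasDerivAt_cubic_energy hu.1 hub hf hφ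
  have h := ((h1.add h2).sub (h3.const_mul (lam / 3))).unique (hcrit.2 φ hφ)
  have e : ∀ x, reaction f lam g α u x * φ x =
      g ((u x - 1) / α) / α * φ x - lam * (max (u x - 1) 0 ^ 2 * f x * φ x) := fun x => by
    rw [reaction]; ring
  simp_rw [e]
  rw [integral_sub i2 (i3.const_mul lam), integral_const_mul]
  linarith

/-- The reaction term of a bounded function is bounded. -/
lemma memLp_reaction [IsFiniteMeasure (volume.restrict Ω)] (hg : IsBump g)
    (hu : MemLp u 2 (volume.restrict Ω)) (hub : ∃ C, ∀ᵐ x ∂volume.restrict Ω, |u x| ≤ C)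
    (hf : MemLp f ⊤ (volume.restrict Ω)) :
    MemLp (reaction f lam g α u) 2 (volume.restrict Ω) := by
  obtain ⟨C, hC⟩ := hub
  obtain ⟨Cf, hCf0, hCf⟩ := exists_ae_abs_le_of_memLp_top hf
  have hum : AEStronglyMeasurable (fun x => u x - 1) (volume.restrict Ω) :=
    hu.1.sub aestronglyMeasurable_const
  have hmax : AEStronglyMeasurable (fun x => max (u x - 1) 0) (volume.restrict Ω) :=
    (continuous_id.max continuous_const).comp_aestronglyMeasurable hum
  refine MemLp.of_bound (((hg.smooth.continuous.comp_aestronglyMeasurable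
    (hum.div₀ aestronglyMeasurable_const)).div₀ aestronglyMeasurable_const).sub
    (((hmax.pow 2).mul hf.1).const_mul lam)) (2 / |α| + |lam| * ((C + 1) ^ 2 * Cf)) ?_
  filter_upwards [hC, hCf] with x h1 h2
  have h3 : |max (u x - 1) 0| ≤ C + 1 := by
    have := (abs_nonneg _).trans h1
    rw [abs_of_nonneg (le_max_right _ _)]
    exact max_le (by linarith [le_abs_self (u x)]) (by linarith)
  have h4 := hg.abs_le ((u x - 1) / α)
  refine (abs_sub _ _).trans ?_
  rw [abs_div, abs_mul, abs_mul, abs_pow]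
  gcongr

end EulerLagrange

/-! ### Smooth convex approximations of the positive part -/

/-- A smooth nondecreasing step: `0` on `(-∞, 0]` and `1` on `[ε, ∞)`. -/
def smoothStep (g : ℝ → ℝ) (ε s : ℝ) : ℝ := ∫ t in (0 : ℝ)..(s / ε), g t

/-- The primitive of `smoothStep`, a smooth convex function within `ε` of the positive part. -/
def smoothPosPart (g : ℝ → ℝ) (ε s : ℝ) : ℝ := ∫ t in (0 : ℝ)..s, smoothStep g ε t

section SmoothPosPart

variable {g : ℝ → ℝ} {ε : ℝ}

lemma hasDerivAt_smoothStep (hg : IsBump g) (s : ℝ) :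
    HasDerivAt (smoothStep g ε) (g (s / ε) / ε) s := by
  have h : HasDerivAt (fun s : ℝ => s / ε) (1 / ε) s := (hasDerivAt_id s).div_const ε
  have h2 := (hg.hasDerivAt_primitive (s / ε)).comp s h
  rw [mul_one_div] at h2
  exact h2

lemma contDiff_smoothStep (hg : IsBump g) : ContDiff ℝ ∞ (smoothStep g ε) := by
  refine contDiff_infty_iff_deriv.2 ⟨fun s => (hasDerivAt_smoothStep hg s).differentiableAt, ?_⟩
  have h : deriv (smoothStep g ε) = _ := funext fun s => (hasDerivAt_smoothStep hg s).deriv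
  rw [h]
  exact (hg.smooth.comp (contDiff_id.div_const ε)).div_const ε

lemma hasDerivAt_smoothPosPart (hg : IsBump g) (s : ℝ) :
    HasDerivAt (smoothPosPart g ε) (smoothStep g ε s) s :=
  have hc := (contDiff_smoothStep (ε := ε) hg).continuous
  intervalIntegral.integral_hasDerivAt_right (hc.intervalIntegrable _ _)
    (hc.stronglyMeasurableAtFilter _ _) hc.continuousAt

lemma contDiff_smoothPosPart (hg : IsBump g) : ContDiff ℝ ∞ (smoothPosPart g ε) := by
  refine contDiff_infty_iff_deriv.2
    ⟨fun s => (hasDerivAt_smoothPosPart hg s).differentiableAt, ?_⟩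
  have h : deriv (smoothPosPart g ε) = _ := funext fun t => (hasDerivAt_smoothPosPart hg t).deriv
  rw [h]
  exact contDiff_smoothStep hg

lemma monotone_smoothStep (hg : IsBump g) (hε : 0 < ε) : Monotone (smoothStep g ε) :=
  monotone_of_hasDerivAt_nonneg (hasDerivAt_smoothStep hg) fun _ =>
    div_nonneg (hg.mem_Icc _).1 hε.le

lemma smoothStep_of_nonpos (hg : IsBump g) (hε : 0 < ε) {s : ℝ} (hs : s ≤ 0) :
    smoothStep g ε s = 0 := by
  have h : s / ε ≤ 0 := div_nonpos_of_nonpos_of_nonneg hs hε.le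
  rw [smoothStep, intervalIntegral.integral_symm, intervalIntegral.integral_congr
    (g := fun _ => (0 : ℝ))]
  · simp
  · intro t ht
    rw [Set.uIcc_of_le h] at ht
    exact hg.zero_left t ht.2

lemma smoothStep_of_le (hg : IsBump g) (hε : 0 < ε) {s : ℝ} (hs : ε ≤ s) :
    smoothStep g ε s = 1 := by
  have h : 1 ≤ s / ε := (one_le_div hε).2 hs
  rw [smoothStep, ← intervalIntegral.integral_add_adjacent_intervals
    (hg.smooth.continuous.intervalIntegrable 0 1)
    (hg.smooth.continuous.intervalIntegrable 1 (s / ε)), hg.integral_one,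
    intervalIntegral.integral_congr (g := fun _ => (0 : ℝ))]
  · simp
  · intro t ht
    rw [Set.uIcc_of_le h] at ht
    exact hg.zero_right t ht.1

lemma smoothStep_mem_Icc (hg : IsBump g) (hε : 0 < ε) (s : ℝ) :
    smoothStep g ε s ∈ Set.Icc (0 : ℝ) 1 := by
  constructor
  · rw [← smoothStep_of_nonpos hg hε (min_le_right s 0)]
    exact monotone_smoothStep hg hε (min_le_left _ _)
  · rw [← smoothStep_of_le hg hε (le_max_right s ε)]
    exact monotone_smoothStep hg hε (le_max_left _ _)

lemma abs_smoothStep_le (hg : IsBump g) (hε : 0 < ε) (s : ℝ) : |smoothStep g ε s| ≤ 1 := by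
  have h := smoothStep_mem_Icc hg hε s
  rw [abs_of_nonneg h.1]; exact h.2

lemma abs_smoothStep_sub_le (hg : IsBump g) (hε : 0 < ε) (s t : ℝ) :
    |smoothStep g ε s - smoothStep g ε t| ≤ 2 / ε * |s - t| := by
  have h := convex_univ.norm_image_sub_le_of_norm_hasDerivWithin_le (C := 2 / ε)
    (fun x _ => (hasDerivAt_smoothStep (ε := ε) hg x).hasDerivWithinAt)
    (fun x _ => by
      rw [Real.norm_eq_abs, abs_div, abs_of_pos hε]
      have := hg.abs_le (x / ε)
      gcongr) (Set.mem_univ t) (Set.mem_univ s)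
  simpa using h

lemma abs_smoothPosPart_sub_le (hg : IsBump g) (hε : 0 < ε) (s t : ℝ) :
    |smoothPosPart g ε s - smoothPosPart g ε t| ≤ |s - t| := by
  have h := convex_univ.norm_image_sub_le_of_norm_hasDerivWithin_le (C := 1)
    (fun x _ => (hasDerivAt_smoothPosPart (ε := ε) hg x).hasDerivWithinAt)
    (fun x _ => abs_smoothStep_le hg hε x) (Set.mem_univ t) (Set.mem_univ s)
  simpa using h

lemma abs_smoothPosPart_sub_max_le (hg : IsBump g) (hε : 0 < ε) (s : ℝ) :
    |smoothPosPart g ε s - max s 0| ≤ ε := by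
  have hint : ∀ a b, IntervalIntegrable (smoothStep g ε) volume a b := fun a b =>
    (contDiff_smoothStep hg).continuous.intervalIntegrable a b
  rcases le_total s 0 with hs | hs
  · have h0 : smoothPosPart g ε s = 0 := by
      rw [smoothPosPart, intervalIntegral.integral_symm, intervalIntegral.integral_congr
        (g := fun _ => (0 : ℝ))]
      · simp
      · intro t ht
        rw [Set.uIcc_of_le hs] at ht
        exact smoothStep_of_nonpos hg hε ht.2
    simp [h0, max_eq_right hs, hε.le]
  · have h0 : smoothPosPart g ε 0 = 0 := by simp [smoothPosPart]
    have h1 : smoothPosPart g ε s ≤ s := by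
      have := abs_smoothPosPart_sub_le hg hε s 0
      rw [h0, sub_zero, sub_zero, abs_of_nonneg hs] at this
      exact (le_abs_self _).trans this
    have h2 : ∀ r, 0 ≤ r → 0 ≤ smoothPosPart g ε r := fun r hr =>
      intervalIntegral.integral_nonneg hr fun t _ => (smoothStep_mem_Icc hg hε t).1
    rw [max_eq_left hs, abs_le]
    refine ⟨?_, by linarith⟩
    rcases le_total s ε with hsε | hsε
    · linarith [h2 s hs]
    · have h3 : smoothPosPart g ε s = smoothPosPart g ε ε + (s - ε) := by
        have h4 : ∫ t in ε..s, smoothStep g ε t = s - ε := by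
          rw [intervalIntegral.integral_congr (g := fun _ => (1 : ℝ))]
          · simp
          · intro t ht
            rw [Set.uIcc_of_le hsε] at ht
            exact smoothStep_of_le hg hε ht.1
        rw [smoothPosPart, smoothPosPart, ← h4,
          intervalIntegral.integral_add_adjacent_intervals (hint _ _) (hint _ _)]
      linarith [h2 ε hε.le]

end SmoothPosPart

/-! ### Kato's inequality for critical points -/

lemma integral_abs_mul_abs_le_sqrt {X : Type*} [MeasurableSpace X] {μ : Measure X} {F e : X → ℝ}
    (hF : MemLp F 2 μ) (he : MemLp e 2 μ) :
    ∫ x, |F x| * |e x| ∂μ ≤ √(∫ x, F x ^ 2 ∂μ) * √(∫ x, e x ^ 2 ∂μ) := by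
  have h := integral_mul_norm_le_Lp_mul_Lq (μ := μ) (p := 2) (q := 2) (f := F) (g := e)
    Real.HolderConjugate.two_two (by simpa using hF) (by simpa using he)
  simpa [Real.sqrt_eq_rpow] using h

section Kato

variable {G : StratifiedGroup N} {Ω : Set (Fin N → ℝ)} {u b φ η : (Fin N → ℝ) → ℝ}
  {v : G.HIdx → (Fin N → ℝ) → ℝ} {g : ℝ → ℝ} {ε : ℝ}

lemma IsTest.memLp_mul (hη : IsTest Ω η) (hb : MemLp b 2 (volume.restrict Ω)) :
    MemLp (fun x => b x * η x) 2 (volume.restrict Ω) := by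
  obtain ⟨C, hC⟩ := hη.exists_bound
  refine MemLp.of_le_mul (c := C) hb (hb.1.mul hη.1.continuous.aestronglyMeasurable)
    (Eventually.of_forall fun x => ?_)
  rw [norm_mul, mul_comm]
  exact mul_le_mul_of_nonneg_right (hC x) (norm_nonneg _)

lemma integrable_smoothPosPart_mul [IsFiniteMeasure (volume.restrict Ω)] (hg : IsBump g)
    (hε : 0 < ε) (hu : MemLp u 2 (volume.restrict Ω)) (hη : IsTest Ω η) :
    Integrable (fun x => smoothPosPart g ε (1 - u x) * η x) (volume.restrict Ω) := by
  obtain ⟨C, hC⟩ := hη.exists_bound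
  have h1 : Integrable (fun x => 1 - u x) (volume.restrict Ω) :=
    (integrable_const _).sub (hu.integrable (by norm_num))
  have h2 : Integrable (fun x => smoothPosPart g ε (1 - u x)) (volume.restrict Ω) := by
    refine h1.mono ((contDiff_smoothPosPart hg).continuous.comp_aestronglyMeasurable h1.1)
      (Eventually.of_forall fun x => ?_)
    simpa [smoothPosPart] using abs_smoothPosPart_sub_le hg hε (1 - u x) 0
  exact h2.mul_bdd (c := C) hη.1.continuous.aestronglyMeasurable
    (Eventually.of_forall fun x => hC x)

/-- Kato's inequality up to an error: the equation is tested with `η H(1 - φ)`, where `φ` is a test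
function near `u`. The error is a sum of products of fixed `L²` functions with `u - φ` and with the
components of `∇u - ∇φ`. -/
lemma neg_error_le_integral_smoothPosPart [IsFiniteMeasure (volume.restrict Ω)] (hg : IsBump g)
    (hε : 0 < ε) (hu : MemLp u 2 (volume.restrict Ω))
    (hv : ∀ i, MemLp (v i) 2 (volume.restrict Ω)) (hb : MemLp b 2 (volume.restrict Ω))
    (hEL : ∀ ψ, IsTest Ω ψ →
      (∫ x in Ω, ∑ i, v i x * G.X i ψ x) + ∫ x in Ω, b x * ψ x = 0)
    (hbu : ∀ x, u x ≤ 1 → b x = 0) (hη : IsTest Ω η) (hη0 : ∀ x, 0 ≤ η x) (hφ : IsTest Ω φ) :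
    -((∫ x in Ω, |(|G.subLaplacian η x| + 2 / ε * |b x * η x|)| * |u x - φ x|)
      + ∑ i, ∫ x in Ω, |(|G.X i η x| + 2 / ε * |v i x * η x|)| * |v i x - G.X i φ x|)
      ≤ ∫ x in Ω, smoothPosPart g ε (1 - u x) * G.subLaplacian η x := by
  set K := smoothPosPart g ε with hK
  set H := smoothStep g ε with hH
  have hone : ContDiff ℝ ∞ fun x => 1 - φ x := contDiff_const.sub hφ.1
  have hHφ : ContDiff ℝ ∞ fun x => H (1 - φ x) := (contDiff_smoothStep hg).comp hone
  have hKφ : ContDiff ℝ ∞ fun x => K (1 - φ x) := (contDiff_smoothPosPart hg).comp hone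
  have hL := hη.subLaplacian G
  have hψ : IsTest Ω fun x => η x * H (1 - φ x) := hη.mul_right hHφ
  have hφd := hφ.differentiable
  have XK : ∀ i x, G.X i (fun y => K (1 - φ y)) x = -(H (1 - φ x) * G.X i φ x) := fun i x =>
    X_comp_one_sub G i (hφd x) (hasDerivAt_smoothPosPart hg _)
  have Xψ : ∀ i x, G.X i (fun y => η y * H (1 - φ y)) x =
      H (1 - φ x) * G.X i η x - η x * (g ((1 - φ x) / ε) / ε) * G.X i φ x := fun i x => by
    rw [X_mul G i (hη.differentiable x) (hHφ.differentiable (by simp)).differentiableAt,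
      X_comp_one_sub G i (hφd x) (hasDerivAt_smoothStep hg _)]
    ring
  -- Green's formula for `K(1 - φ)` and the equation tested with `η H(1 - φ)`
  have h1 := integral_mul_subLaplacian G hKφ hη
  have h2 := hEL _ hψ
  have iX : ∀ i, MemLp (G.X i η) 2 (volume.restrict Ω) := fun i => (hη.X G i).memLp 2 _
  have i1 := integrable_smoothPosPart_mul hg hε hu hL
  have i2 : Integrable (fun x => K (1 - φ x) * G.subLaplacian η x) (volume.restrict Ω) :=
    integrable_smoothPosPart_mul hg hε (hφ.memLp 2 _) hL
  have i3 : Integrable (fun x => ∑ i, G.X i (fun y => K (1 - φ y)) x * G.X i η x)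
      (volume.restrict Ω) := integrable_finsetSum _ fun i _ => by
    have : IsTest Ω fun x => G.X i η x * G.X i (fun y => K (1 - φ y)) x :=
      (hη.X G i).mul_right (contDiff_X G i hKφ)
    simpa only [mul_comm] using this.integrable (volume.restrict Ω)
  have i4 : Integrable (fun x => ∑ i, v i x * G.X i (fun y => η y * H (1 - φ y)) x)
      (volume.restrict Ω) := integrable_finsetSum _ fun i _ =>
    (hv i).integrable_mul ((hψ.X G i).memLp 2 _)
  have i5 : Integrable (fun x => b x * (η x * H (1 - φ x))) (volume.restrict Ω) :=
    hb.integrable_mul (hψ.memLp 2 _)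
  have j0 : Integrable (fun x => |(|G.subLaplacian η x| + 2 / ε * |b x * η x|)| * |u x - φ x|)
      (volume.restrict Ω) :=
    ((hL.memLp 2 _).abs.add ((hη.memLp_mul hb).abs.const_mul _)).abs.integrable_mul
      (hu.sub (hφ.memLp 2 _)).abs
  have j1 : ∀ i, Integrable
      (fun x => |(|G.X i η x| + 2 / ε * |v i x * η x|)| * |v i x - G.X i φ x|)
      (volume.restrict Ω) := fun i =>
    ((iX i).abs.add ((hη.memLp_mul (hv i)).abs.const_mul _)).abs.integrable_mul
      ((hv i).sub ((hφ.X G i).memLp 2 _)).abs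
  have k1 : ∫ x in Ω, K (1 - u x) * G.subLaplacian η x =
      ∫ x in Ω, (K (1 - u x) * G.subLaplacian η x - (K (1 - φ x) * G.subLaplacian η x
        + ∑ i, G.X i (fun y => K (1 - φ y)) x * G.X i η x)
        - ((∑ i, v i x * G.X i (fun y => η y * H (1 - φ y)) x)
          + b x * (η x * H (1 - φ x)))) := by
    have a1 : ∫ x in Ω, (K (1 - φ x) * G.subLaplacian η x
        + ∑ i, G.X i (fun y => K (1 - φ y)) x * G.X i η x) = 0 := by
      rw [integral_add i2 i3, h1]; ring
    have a2 : ∫ x in Ω, ((∑ i, v i x * G.X i (fun y => η y * H (1 - φ y)) x)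
        + b x * (η x * H (1 - φ x))) = 0 := by
      rw [integral_add i4 i5, h2]
    have a3 : Integrable (fun x => K (1 - φ x) * G.subLaplacian η x
        + ∑ i, G.X i (fun y => K (1 - φ y)) x * G.X i η x) (volume.restrict Ω) := i2.add i3
    have a4 : Integrable (fun x => (∑ i, v i x * G.X i (fun y => η y * H (1 - φ y)) x)
        + b x * (η x * H (1 - φ x))) (volume.restrict Ω) := i4.add i5
    have a5 : Integrable (fun x => K (1 - u x) * G.subLaplacian η x -
        (K (1 - φ x) * G.subLaplacian η x
        + ∑ i, G.X i (fun y => K (1 - φ y)) x * G.X i η x)) (volume.restrict Ω) := i1.sub a3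
    rw [integral_sub a5 a4, integral_sub i1 a3, a1, a2]
    ring
  rw [k1, ← integral_finsetSum _ fun i _ => j1 i,
    ← integral_add j0 (integrable_finsetSum _ fun i _ => j1 i), ← integral_neg]
  refine integral_mono (j0.add (integrable_finsetSum _ fun i _ => j1 i)).neg
    ((i1.sub (i2.add i3)).sub (i4.add i5)) fun x => ?_
  set h := g ((1 - φ x) / ε) / ε with hh
  have hh0 : 0 ≤ h := div_nonneg (hg.mem_Icc _).1 hε.le
  have hh2 : h ≤ 2 / ε := div_le_div_of_nonneg_right (hg.mem_Icc _).2 hε.le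
  have p1 : -(|G.subLaplacian η x| * |u x - φ x|)
      ≤ (K (1 - u x) - K (1 - φ x)) * G.subLaplacian η x := by
    have e1 := abs_smoothPosPart_sub_le hg hε (1 - u x) (1 - φ x)
    have e2 : |1 - u x - (1 - φ x)| = |u x - φ x| := by
      rw [abs_sub_comm]; congr 1; ring
    rw [e2, ← hK] at e1
    have e3 := neg_abs_le ((K (1 - u x) - K (1 - φ x)) * G.subLaplacian η x)
    rw [abs_mul] at e3
    have e4 := mul_le_mul_of_nonneg_right e1 (abs_nonneg (G.subLaplacian η x))
    linarith [mul_comm |u x - φ x| |G.subLaplacian η x|]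
  have p2 : -(2 / ε * |b x * η x| * |u x - φ x|) ≤ -(b x * (η x * H (1 - φ x))) := by
    have e0 : b x * H (1 - u x) = 0 := by
      rcases le_total (u x) 1 with hx | hx
      · rw [hbu x hx, zero_mul]
      · rw [hH, smoothStep_of_nonpos hg hε (by linarith), mul_zero]
    have e1 := abs_smoothStep_sub_le hg hε (1 - φ x) (1 - u x)
    have e2 : |1 - φ x - (1 - u x)| = |u x - φ x| := by congr 1; ring
    rw [e2, ← hH] at e1
    have e3 : b x * (η x * H (1 - φ x)) = b x * η x * (H (1 - φ x) - H (1 - u x)) := by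
      linear_combination η x * e0
    rw [e3]
    have e4 := le_abs_self (b x * η x * (H (1 - φ x) - H (1 - u x)))
    rw [abs_mul] at e4
    have e5 := mul_le_mul_of_nonneg_left e1 (abs_nonneg (b x * η x))
    linarith
  have p3 : ∀ i, -((|G.X i η x| + 2 / ε * |v i x * η x|) * |v i x - G.X i φ x|) ≤
      H (1 - φ x) * G.X i φ x * G.X i η x
        - v i x * (H (1 - φ x) * G.X i η x - η x * h * G.X i φ x) := by
    intro i
    have e1 : H (1 - φ x) * G.X i φ x * G.X i η x
        - v i x * (H (1 - φ x) * G.X i η x - η x * h * G.X i φ x) =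
        η x * h * v i x ^ 2 - H (1 - φ x) * (G.X i η x * (v i x - G.X i φ x))
          - h * (v i x * η x * (v i x - G.X i φ x)) := by ring
    have e2 : 0 ≤ η x * h * v i x ^ 2 := mul_nonneg (mul_nonneg (hη0 x) hh0) (sq_nonneg _)
    have e3 : H (1 - φ x) * (G.X i η x * (v i x - G.X i φ x)) ≤
        |G.X i η x| * |v i x - G.X i φ x| := by
      refine (le_abs_self _).trans ?_
      rw [abs_mul, abs_mul]
      exact mul_le_of_le_one_left (by positivity) (abs_smoothStep_le hg hε _)
    have e4 : h * (v i x * η x * (v i x - G.X i φ x)) ≤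
        2 / ε * (|v i x * η x| * |v i x - G.X i φ x|) := by
      refine (le_abs_self _).trans ?_
      rw [abs_mul, abs_mul _ (v i x - G.X i φ x), abs_of_nonneg hh0]
      exact mul_le_mul_of_nonneg_right hh2 (by positivity)
    rw [e1]
    linarith [add_mul |G.X i η x| (2 / ε * |v i x * η x|) |v i x - G.X i φ x|]
  have p4 := Finset.sum_le_sum fun i (_ : i ∈ Finset.univ) => p3 i
  rw [Finset.sum_neg_distrib, Finset.sum_sub_distrib] at p4
  have habs : ∀ i, |(|G.X i η x| + 2 / ε * |v i x * η x|)| =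
      |G.X i η x| + 2 / ε * |v i x * η x| := fun i => abs_of_nonneg (by positivity)
  have habs0 : |(|G.subLaplacian η x| + 2 / ε * |b x * η x|)| =
      |G.subLaplacian η x| + 2 / ε * |b x * η x| := abs_of_nonneg (by positivity)
  simp only [habs, habs0, XK, Xψ, neg_mul, Finset.sum_neg_distrib]
  rw [← hh]
  linarith [add_mul |G.subLaplacian η x| (2 / ε * |b x * η x|) |u x - φ x|,
    sub_mul (K (1 - u x)) (K (1 - φ x)) (G.subLaplacian η x)]

/-- **Kato's inequality**: if `u ∈ W₀^{1,2}(Ω)` satisfies `𝓛 u = b` with `b = 0` on `{u ≤ 1}`, then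
`𝓛 K(1 - u) ≥ 0` for the smooth convex approximations `K` of the positive part. -/
lemma integral_smoothPosPart_subLaplacian_nonneg [IsFiniteMeasure (volume.restrict Ω)]
    (hΩ : IsOpen Ω) (hg : IsBump g) (hε : 0 < ε) (hu : MemW120 G Ω u)
    (hb : MemLp b 2 (volume.restrict Ω))
    (hEL : ∀ ψ, IsTest Ω ψ →
      (∫ x in Ω, ∑ i, hGrad G Ω u i x * G.X i ψ x) + ∫ x in Ω, b x * ψ x = 0)
    (hbu : ∀ x, u x ≤ 1 → b x = 0) (hη : IsTest Ω η) (hη0 : ∀ x, 0 ≤ η x) :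
    0 ≤ ∫ x in Ω, smoothPosPart g ε (1 - u x) * G.subLaplacian η x := by
  set v := hGrad G Ω u with hv
  have hv2 : ∀ i, MemLp (v i) 2 (volume.restrict Ω) := hu.1.memLp_hGrad hΩ
  have hF0 : MemLp (fun x => |G.subLaplacian η x| + 2 / ε * |b x * η x|) 2 (volume.restrict Ω) :=
    ((hη.subLaplacian G).memLp 2 _).abs.add ((hη.memLp_mul hb).abs.const_mul _)
  have hF : ∀ i, MemLp (fun x => |G.X i η x| + 2 / ε * |v i x * η x|) 2 (volume.restrict Ω) :=
    fun i => ((hη.X G i).memLp 2 _).abs.add ((hη.memLp_mul (hv2 i)).abs.const_mul _)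
  set D := √(∫ x in Ω, (|G.subLaplacian η x| + 2 / ε * |b x * η x|) ^ 2)
    + ∑ i, √(∫ x in Ω, (|G.X i η x| + 2 / ε * |v i x * η x|) ^ 2) with hD
  have key : ∀ δ : ℝ, 0 < δ → -(D * δ) ≤
      ∫ x in Ω, smoothPosPart g ε (1 - u x) * G.subLaplacian η x := by
    intro δ hδ
    obtain ⟨φ, hφ, hφδ⟩ := hu.2 δ hδ
    refine le_trans (neg_le_neg ?_)
      (neg_error_le_integral_smoothPosPart hg hε hu.1.1 hv2 hb hEL hbu hη hη0 hφ)
    have hdiff : ∀ i, hGrad G Ω (fun x => u x - φ x) i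
        =ᵐ[volume.restrict Ω] fun x => v i x - G.X i φ x := by
      intro i
      have h := (hu.1.isWeakHGrad.add_const_mul_test hφ (-1)).hGrad_ae_eq hΩ i
      simpa [sub_eq_add_neg] using h
    have he : ∀ i, MemLp (fun x => v i x - G.X i φ x) 2 (volume.restrict Ω) := fun i =>
      (hv2 i).sub ((hφ.X G i).memLp 2 _)
    have hgrad : ∀ i, √(∫ x in Ω, (v i x - G.X i φ x) ^ 2) ≤
        √(∫ x in Ω, ∑ i, hGrad G Ω (fun x => u x - φ x) i x ^ 2) := by
      intro i
      refine Real.sqrt_le_sqrt ?_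
      have hae := ae_all_iff.2 hdiff
      refine integral_mono_ae (he i).integrable_sq ?_ ?_
      · refine (integrable_finsetSum Finset.univ fun i _ => (he i).integrable_sq).congr ?_
        filter_upwards [hae] with x hx
        simp only [hx]
      · filter_upwards [hae] with x hx
        simp only [hx]
        exact Finset.single_le_sum (f := fun i => (v i x - G.X i φ x) ^ 2)
          (fun i _ => sq_nonneg _) (Finset.mem_univ i)
    rw [w12Norm] at hφδ
    have s1 := Real.sqrt_nonneg (∫ x in Ω, (u x - φ x) ^ 2)
    have s2 := Real.sqrt_nonneg (∫ x in Ω, ∑ i, hGrad G Ω (fun x => u x - φ x) i x ^ 2)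
    rw [hD, add_mul, Finset.sum_mul]
    refine add_le_add ?_ (Finset.sum_le_sum fun i _ => ?_)
    · refine (integral_abs_mul_abs_le_sqrt hF0 (hu.1.1.sub (hφ.memLp 2 _))).trans ?_
      refine mul_le_mul_of_nonneg_left ?_ (Real.sqrt_nonneg _)
      simp only [Pi.sub_apply]
      linarith
    · refine (integral_abs_mul_abs_le_sqrt (hF i) (he i)).trans ?_
      refine mul_le_mul_of_nonneg_left ?_ (Real.sqrt_nonneg _)
      linarith [hgrad i]
  have hlim : Tendsto (fun δ : ℝ => -(D * δ)) (𝓝[>] 0) (𝓝 0) := by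
    have hc : Continuous fun δ : ℝ => -(D * δ) := by fun_prop
    simpa using (hc.tendsto 0).mono_left nhdsWithin_le_nhds
  refine le_of_tendsto hlim ?_
  filter_upwards [self_mem_nhdsWithin] with δ hδ
  exact key δ hδ

end Kato

/-! ### Passage to the limit -/

section Limit

variable {G : StratifiedGroup N} {Ω : Set (Fin N → ℝ)} {u ψ η φ : (Fin N → ℝ) → ℝ}
  {f : (Fin N → ℝ) → ℝ} {lam : ℝ} {g : ℝ → ℝ} {α : ℕ → ℝ} {uj : ℕ → (Fin N → ℝ) → ℝ}

lemma IsTest.integrable_mul_of_memLp (hψ : IsTest Ω ψ) (hu : MemLp u 2 (volume.restrict Ω)) :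
    Integrable (fun x => u x * ψ x) (volume.restrict Ω) :=
  hu.integrable_mul (hψ.memLp 2 _)

lemma tendsto_setIntegral_mul_of_tendstoUniformlyOn {F : ℕ → (Fin N → ℝ) → ℝ}
    (hΩ : MeasurableSet Ω) (hF : TendstoUniformlyOn F u atTop Ω) (hψ : IsTest Ω ψ)
    (hi : ∀ j, Integrable (fun x => F j x * ψ x) (volume.restrict Ω))
    (hu : Integrable (fun x => u x * ψ x) (volume.restrict Ω)) :
    Tendsto (fun j => ∫ x in Ω, F j x * ψ x) atTop (𝓝 (∫ x in Ω, u x * ψ x)) := by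
  rw [Metric.tendsto_atTop]
  intro ε hε
  set D := ∫ x in Ω, |ψ x| with hD
  have hD0 : 0 ≤ D := integral_nonneg fun x => abs_nonneg _
  have hψi : Integrable (fun x => |ψ x|) (volume.restrict Ω) := (hψ.integrable _).abs
  obtain ⟨n, hn⟩ := eventually_atTop.1
    (Metric.tendstoUniformlyOn_iff.1 hF (ε / (D + 1)) (by positivity))
  refine ⟨n, fun j hj => ?_⟩
  rw [Real.dist_eq, ← integral_sub (hi j) hu]
  calc |∫ x in Ω, (F j x * ψ x - u x * ψ x)| ≤ ∫ x in Ω, ε / (D + 1) * |ψ x| := by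
        rw [← Real.norm_eq_abs]
        refine norm_integral_le_of_norm_le (hψi.const_mul _) ?_
        filter_upwards [ae_restrict_mem hΩ] with x hx
        have h := hn j hj x hx
        rw [dist_comm, Real.dist_eq] at h
        rw [← sub_mul, norm_mul, Real.norm_eq_abs, Real.norm_eq_abs]
        gcongr
    _ = ε * (D / (D + 1)) := by rw [integral_const_mul, ← hD]; ring
    _ < ε * 1 := by
        gcongr
        rw [div_lt_one (by positivity)]
        linarith
    _ = ε := mul_one ε

lemma memLp_limit [IsFiniteMeasure (volume.restrict Ω)] (hΩ : IsOpen Ω)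
    (hL : ∃ C : ℝ, ∀ j, ∀ᵐ x ∂(volume.restrict Ω), |uj j x| ≤ C)
    (hu : ContinuousOn u Ω) (hlim : TendstoUniformlyOn uj u atTop Ω) :
    MemLp u 2 (volume.restrict Ω) := by
  obtain ⟨C, hC⟩ := hL
  obtain ⟨j, hj⟩ := (Metric.tendstoUniformlyOn_iff.1 hlim 1 one_pos).exists
  refine MemLp.of_bound (hu.aestronglyMeasurable hΩ.measurableSet) (C + 1) ?_
  filter_upwards [hC j, ae_restrict_mem hΩ.measurableSet] with x h1 hx
  have h2 := hj x hx
  rw [Real.dist_eq] at h2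
  have h3 := abs_add_le (u x - uj j x) (uj j x)
  rw [sub_add_cancel] at h3
  rw [Real.norm_eq_abs]
  linarith

lemma integrable_negPart_mul [IsFiniteMeasure (volume.restrict Ω)]
    (hu : MemLp u 2 (volume.restrict Ω)) (hψ : IsTest Ω ψ) :
    Integrable (fun x => max (1 - u x) 0 * ψ x) (volume.restrict Ω) := by
  obtain ⟨C, hC⟩ := hψ.exists_bound
  have h1 : Integrable (fun x => 1 - u x) (volume.restrict Ω) :=
    (integrable_const _).sub (hu.integrable (by norm_num))
  exact h1.pos_part.mul_bdd (c := C) hψ.1.continuous.aestronglyMeasurable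
    (Eventually.of_forall fun x => hC x)

/-- The distribution `𝓛(u - 1)₋` is nonnegative. -/
lemma integral_negPart_subLaplacian_nonneg [IsFiniteMeasure (volume.restrict Ω)]
    (hΩ : IsOpen Ω) (hf : MemLp f ⊤ (volume.restrict Ω)) (hg : IsBump g) (hα : ∀ j, 0 < α j)
    (hcrit : ∀ j, IsCriticalPoint G Ω f lam g (α j) (uj j))
    (hL : ∃ C : ℝ, ∀ j, ∀ᵐ x ∂(volume.restrict Ω), |uj j x| ≤ C)
    (hu : MemLp u 2 (volume.restrict Ω)) (hlim : TendstoUniformlyOn uj u atTop Ω)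
    (hη : IsTest Ω η) (hη0 : ∀ x, 0 ≤ η x) :
    0 ≤ ∫ x in Ω, max (1 - u x) 0 * G.subLaplacian η x := by
  have hub : ∀ j, ∃ C, ∀ᵐ x ∂volume.restrict Ω, |uj j x| ≤ C := fun j => hL.imp fun _ h => h j
  have hLη := hη.subLaplacian G
  have h1 : ∀ ε : ℝ, 0 < ε → 0 ≤ ∫ x in Ω, smoothPosPart g ε (1 - u x) * G.subLaplacian η x := by
    intro ε hε
    have hunif : TendstoUniformlyOn (fun j x => smoothPosPart g ε (1 - uj j x))
        (fun x => smoothPosPart g ε (1 - u x)) atTop Ω := by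
      rw [Metric.tendstoUniformlyOn_iff] at hlim ⊢
      intro δ hδ
      filter_upwards [hlim δ hδ] with j hj x hx
      refine lt_of_le_of_lt ?_ (hj x hx)
      rw [Real.dist_eq, Real.dist_eq]
      refine (abs_smoothPosPart_sub_le hg hε _ _).trans_eq ?_
      rw [abs_sub_comm]; congr 1; ring
    refine ge_of_tendsto' (tendsto_setIntegral_mul_of_tendstoUniformlyOn hΩ.measurableSet hunif hLη
      (fun j => integrable_smoothPosPart_mul hg hε (hcrit j).1.1.1 hLη)
      (integrable_smoothPosPart_mul hg hε hu hLη)) fun j => ?_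
    exact integral_smoothPosPart_subLaplacian_nonneg hΩ hg hε (hcrit j).1
      (memLp_reaction hg (hcrit j).1.1.1 (hub j) hf)
      (fun ψ hψ => (hcrit j).euler_lagrange hΩ hg (hub j) hf hψ)
      (fun x hx => reaction_eq_zero hg (hα j) hx) hη hη0
  have hpos : ∀ n : ℕ, 0 < 1 / ((n : ℝ) + 1) := fun n => Nat.one_div_pos_of_nat
  have hunif : TendstoUniformlyOn (fun (n : ℕ) x => smoothPosPart g (1 / ((n : ℝ) + 1)) (1 - u x))
      (fun x => max (1 - u x) 0) atTop Ω := by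
    rw [Metric.tendstoUniformlyOn_iff]
    intro δ hδ
    filter_upwards [tendsto_one_div_add_atTop_nhds_zero_nat.eventually_lt_const hδ] with n hn x _
    rw [dist_comm, Real.dist_eq]
    exact (abs_smoothPosPart_sub_max_le hg (hpos n) _).trans_lt hn
  exact ge_of_tendsto' (tendsto_setIntegral_mul_of_tendstoUniformlyOn hΩ.measurableSet hunif hLη
    (fun n => integrable_smoothPosPart_mul hg (hpos n) hu hLη) (integrable_negPart_mul hu hLη))
    fun n => h1 _ (hpos n)

lemma subLaplacian_eq_zero (G : StratifiedGroup N) {x : Fin N → ℝ} (hx : x ∉ tsupport φ) :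
    G.subLaplacian φ x = 0 :=
  Finset.sum_eq_zero fun i _ => image_eq_zero_of_notMem_tsupport fun h =>
    hx (tsupport_X_subset G i φ (tsupport_X_subset G i (G.X i φ) h))

lemma IsWeakHGrad.integral_mul_subLaplacian {v : G.HIdx → (Fin N → ℝ) → ℝ}
    (h : IsWeakHGrad G Ω u v) (hφ : IsTest Ω φ) :
    ∫ x in Ω, u x * G.subLaplacian φ x = -∫ x in Ω, ∑ i, v i x * G.X i φ x := by
  simp only [StratifiedGroup.subLaplacian, Finset.mul_sum]
  rw [integral_finsetSum _ fun i _ =>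
      (((hφ.X G i).X G i).integrable_mul_of_locallyIntegrableOn h.1).integrableOn,
    integral_finsetSum _ fun i _ =>
      ((hφ.X G i).integrable_mul_of_locallyIntegrableOn (h.2 i).1).integrableOn,
    ← Finset.sum_neg_distrib]
  exact Finset.sum_congr rfl fun i _ => (h.2 i).2 _ (hφ.X G i)

/-- The limit is harmonic where it lies below `1`: on a compact subset of `{u < 1}` the reaction
terms of the approximations are eventually zero. -/
lemma integral_negPart_subLaplacian_eq_zero [IsFiniteMeasure (volume.restrict Ω)]
    (hΩ : IsOpen Ω) (hf : MemLp f ⊤ (volume.restrict Ω)) (hg : IsBump g) (hα : ∀ j, 0 < α j)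
    (hcrit : ∀ j, IsCriticalPoint G Ω f lam g (α j) (uj j))
    (hL : ∃ C : ℝ, ∀ j, ∀ᵐ x ∂(volume.restrict Ω), |uj j x| ≤ C)
    (hu : MemLp u 2 (volume.restrict Ω)) (huc : ContinuousOn u Ω)
    (hlim : TendstoUniformlyOn uj u atTop Ω)
    (hφ : IsTest Ω φ) (hlt : ∀ x ∈ tsupport φ, u x < 1) :
    ∫ x in Ω, max (1 - u x) 0 * G.subLaplacian φ x = 0 := by
  have hLφ := hφ.subLaplacian G
  obtain ⟨δ, hδ, hm⟩ := IsCompact.exists_forall_le' hφ.2.1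
    (continuousOn_const.sub (huc.mono hφ.2.2)) fun x hx => sub_pos.2 (hlt x hx)
  have h0 : ∀ᶠ j in atTop, ∫ x in Ω, uj j x * G.subLaplacian φ x = 0 := by
    filter_upwards [Metric.tendstoUniformlyOn_iff.1 hlim δ hδ] with j hj
    have hEL := (hcrit j).euler_lagrange hΩ hg (hL.imp fun _ h => h j) hf hφ
    have hr : ∀ x, reaction f lam g (α j) (uj j) x * φ x = 0 := by
      intro x
      by_cases hx : x ∈ tsupport φ
      · have h1 := hj x (hφ.2.2 hx)
        rw [dist_comm, Real.dist_eq] at h1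
        have hmx : δ ≤ 1 - u x := hm x hx
        have h2 : uj j x ≤ 1 := by linarith [le_abs_self (uj j x - u x)]
        rw [reaction_eq_zero hg (hα j) h2, zero_mul]
      · rw [image_eq_zero_of_notMem_tsupport hx, mul_zero]
    simp only [hr, integral_zero, add_zero] at hEL
    rw [(hcrit j).1.1.isWeakHGrad.integral_mul_subLaplacian hφ, hEL, neg_zero]
  have h1 := tendsto_setIntegral_mul_of_tendstoUniformlyOn hΩ.measurableSet hlim hLφ
    (fun j => hLφ.integrable_mul_of_memLp (hcrit j).1.1.1) (hLφ.integrable_mul_of_memLp hu)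
  have h2 : ∫ x in Ω, u x * G.subLaplacian φ x = 0 :=
    tendsto_nhds_unique h1 (tendsto_const_nhds.congr' (h0.mono fun _ h => h.symm))
  have h3 : ∀ x, max (1 - u x) 0 * G.subLaplacian φ x =
      G.subLaplacian φ x - u x * G.subLaplacian φ x := by
    intro x
    by_cases hx : x ∈ tsupport φ
    · rw [max_eq_left (by linarith [hlt x hx])]; ring
    · rw [subLaplacian_eq_zero G hx]; ring
  simp_rw [h3]
  rw [integral_sub (hLφ.integrable _) (hLφ.integrable_mul_of_memLp hu), integral_subLaplacian G hφ,
    h2, sub_zero]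

end Limit

/-! ### Local Sobolev regularity of the limit -/

/-- Bounded sequences in `L²` have weakly convergent subsequences. -/
lemma exists_weak_limit {X : Type*} [MeasurableSpace X] {μ : Measure X}
    [MeasurableSpace.CountablyGenerated X] [SFinite μ]
    {v : ℕ → X → ℝ} (hv : ∀ j, MemLp (v j) 2 μ) {C : ℝ} (hC : ∀ j, √(∫ x, v j x ^ 2 ∂μ) ≤ C) :
    ∃ w, MemLp w 2 μ ∧ ∃ θ : ℕ → ℕ, StrictMono θ ∧ ∀ φ, MemLp φ 2 μ →
      Tendsto (fun j => ∫ x, v (θ j) x * φ x ∂μ) atTop (𝓝 (∫ x, w x * φ x ∂μ)) := by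
  have hinner : ∀ a b : X → ℝ, ∀ (ha : MemLp a 2 μ) (hb : MemLp b 2 μ),
      inner ℝ (ha.toLp a) (hb.toLp b) = ∫ x, a x * b x ∂μ := by
    intro a b ha hb
    rw [L2.inner_def]
    refine integral_congr_ae ?_
    filter_upwards [ha.coeFn_toLp, hb.coeFn_toLp] with x h1 h2
    simp only [h1, h2, RCLike.inner_apply, conj_trivial]
    ring
  let L : ℕ → WeakDual ℝ (Lp ℝ 2 μ) := fun j =>
    StrongDual.toWeakDual (InnerProductSpace.toDual ℝ _ ((hv j).toLp (v j)))
  have hmem : ∀ j, L j ∈ WeakDual.toStrongDual ⁻¹' Metric.closedBall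
      (0 : StrongDual ℝ (Lp ℝ 2 μ)) C := by
    intro j
    have hn : ‖(hv j).toLp (v j)‖ ≤ C := by
      refine le_trans (le_of_eq ?_) (hC j)
      rw [← Real.sqrt_sq (norm_nonneg ((hv j).toLp (v j))), ← real_inner_self_eq_norm_sq, hinner]
      simp only [sq]
    have : ‖InnerProductSpace.toDual ℝ _ ((hv j).toLp (v j))‖ ≤ C := by
      rw [LinearIsometryEquiv.norm_map]; exact hn
    simpa [L] using this
  have : Fact ((2 : ENNReal) ≠ ⊤) := ⟨by simp⟩
  obtain ⟨ℓ, -, θ, hθ, hlim⟩ := WeakDual.isSeqCompact_closedBall ℝ (Lp ℝ 2 μ) 0 C hmem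
  let W := (InnerProductSpace.toDual ℝ (Lp ℝ 2 μ)).symm (WeakDual.toStrongDual ℓ)
  have hW : MemLp W 2 μ := Lp.memLp W
  refine ⟨W, hW, θ, hθ, fun φ hφ => ?_⟩
  have h1 := ((WeakDual.eval_continuous (hφ.toLp φ)).tendsto ℓ).comp hlim
  have h2 : ℓ (hφ.toLp φ) = ∫ x, W x * φ x ∂μ := by
    rw [← hinner _ _ hW hφ, Lp.toLp_coeFn, InnerProductSpace.toDual_symm_apply]
    rfl
  rw [h2] at h1
  refine h1.congr fun j => ?_
  rw [← hinner _ _ (hv (θ j)) hφ]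
  rfl

section Regularity

variable {G : StratifiedGroup N} {Ω Ω' : Set (Fin N → ℝ)} {u : (Fin N → ℝ) → ℝ}
  {uj : ℕ → (Fin N → ℝ) → ℝ}

lemma sqrt_integral_hGrad_sq_le_w12Norm (hΩ : IsOpen Ω) (h : MemW12 G Ω u) (i : G.HIdx) :
    √(∫ x in Ω, hGrad G Ω u i x ^ 2) ≤ w12Norm G Ω u := by
  have h1 : √(∫ x in Ω, hGrad G Ω u i x ^ 2) ≤ √(∫ x in Ω, ∑ i, hGrad G Ω u i x ^ 2) := by
    refine Real.sqrt_le_sqrt (integral_mono (h.memLp_hGrad hΩ i).integrable_sq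
      (integrable_finsetSum _ fun i _ => (h.memLp_hGrad hΩ i).integrable_sq) fun x => ?_)
    exact Finset.single_le_sum (f := fun i => hGrad G Ω u i x ^ 2)
      (fun i _ => sq_nonneg _) (Finset.mem_univ i)
  have h2 := Real.sqrt_nonneg (∫ x in Ω, u x ^ 2)
  rw [w12Norm]
  linarith

/-- A uniform limit of functions bounded in `W^{1,2}(Ω)` is in `W^{1,2}(Ω)`. -/
lemma memW12_of_tendstoUniformlyOn [IsFiniteMeasure (volume.restrict Ω)] (hΩ : IsOpen Ω)
    (huj : ∀ j, MemW12 G Ω (uj j)) (hW : ∃ C : ℝ, ∀ j, w12Norm G Ω (uj j) ≤ C)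
    (hu : MemLp u 2 (volume.restrict Ω)) (hlim : TendstoUniformlyOn uj u atTop Ω) :
    MemW12 G Ω u := by
  obtain ⟨C, hC⟩ := hW
  have hloc : ∀ w : (Fin N → ℝ) → ℝ, MemLp w 2 (volume.restrict Ω) → LocallyIntegrableOn w Ω :=
    fun w hw => IntegrableOn.locallyIntegrableOn (hw.integrable (by norm_num))
  choose w hw θ hθ hwlim using fun i => exists_weak_limit
    (fun j => (huj j).memLp_hGrad hΩ i)
    (fun j => (sqrt_integral_hGrad_sq_le_w12Norm hΩ (huj j) i).trans (hC j))
  refine ⟨hu, w, ⟨hloc u hu, fun i => ⟨hloc _ (hw i), fun φ hφ => ?_⟩⟩, hw⟩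
  have hX := hφ.X G i
  have h1 := (tendsto_setIntegral_mul_of_tendstoUniformlyOn hΩ.measurableSet hlim hX
    (fun j => hX.integrable_mul_of_memLp (huj j).1) (hX.integrable_mul_of_memLp hu)).comp
    (hθ i).tendsto_atTop
  refine tendsto_nhds_unique h1 ((hwlim i φ (hφ.memLp 2 _)).neg.congr fun j => ?_)
  exact (((huj (θ i j)).isWeakHGrad.2 i).2 φ hφ).symm

lemma MemW12.mono (h : MemW12 G Ω u) (hΩ' : Ω' ⊆ Ω) : MemW12 G Ω' u := by
  obtain ⟨hu, v, hv, hv2⟩ := h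
  have hle : volume.restrict Ω' ≤ volume.restrict Ω := Measure.restrict_mono hΩ' le_rfl
  refine ⟨hu.mono_measure hle, v, ⟨hv.1.mono_set hΩ', fun i =>
    ⟨(hv.2 i).1.mono_set hΩ', fun φ hφ => ?_⟩⟩, fun i => (hv2 i).mono_measure hle⟩
  have e : ∀ (w ψ : (Fin N → ℝ) → ℝ), IsTest Ω' ψ →
      ∫ x in Ω', w x * ψ x = ∫ x in Ω, w x * ψ x := fun w ψ hψ => by
    rw [setIntegral_eq_integral_of_forall_compl_eq_zero fun x hx => by simp [hψ.eq_zero hx],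
      setIntegral_eq_integral_of_forall_compl_eq_zero fun x hx => by
        simp [(hψ.mono hΩ').eq_zero hx]]
  rw [e _ _ (hφ.X G i), e _ _ hφ]
  exact (hv.2 i).2 φ (hφ.mono hΩ')

end Regularity

/-! ### Positive distributions are Radon measures -/

section Radon

open CompactlySupported
open scoped Manifold

variable {Ω V : Set (Fin N → ℝ)} {φ : (Fin N → ℝ) → ℝ}

lemma exists_isTest_one_on {K : Set (Fin N → ℝ)} (hK : IsCompact K) (hV : IsOpen V)
    (hKV : K ⊆ V) :
    ∃ χ, IsTest V χ ∧ (∀ x ∈ K, χ x = 1) ∧ ∀ x, χ x ∈ Set.Icc (0 : ℝ) 1 := by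
  obtain ⟨L, hL, hKL, hLV⟩ := exists_compact_between hK hV hKV
  obtain ⟨χ, h1, h0, h01⟩ := exists_contMDiffMap_one_nhds_of_subset_interior
    𝓘(ℝ, Fin N → ℝ) (n := ⊤) hK.isClosed hKL
  have hts : tsupport χ ⊆ L := closure_minimal
    (fun x hx => by_contra fun h => hx (h0 x h)) hL.isClosed
  exact ⟨χ, ⟨χ.contMDiff.contDiff, hL.of_isClosed_subset (isClosed_tsupport _) hts,
    hts.trans hLV⟩, fun x hx => h1.self_of_nhdsSet x hx, h01⟩

open Classical in
/-- Extension by zero of a function on `Ω`. -/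
def extendZero (ψ : Ω → ℝ) (x : Fin N → ℝ) : ℝ := if h : x ∈ Ω then ψ ⟨x, h⟩ else 0

lemma extendZero_add (ψ₁ ψ₂ : Ω → ℝ) :
    extendZero (fun x => ψ₁ x + ψ₂ x) = fun x => extendZero ψ₁ x + extendZero ψ₂ x := by
  funext x
  by_cases h : x ∈ Ω <;> simp [extendZero, h]

lemma extendZero_const_mul (c : ℝ) (ψ : Ω → ℝ) :
    extendZero (fun x => c * ψ x) = fun x => c * extendZero ψ x := by
  funext x
  by_cases h : x ∈ Ω <;> simp [extendZero, h]

lemma IsTest.extendZero_restrict (hφ : IsTest Ω φ) :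
    extendZero (fun x : Ω => φ x) = φ := by
  funext x
  by_cases h : x ∈ Ω
  · simp [extendZero, h]
  · simp [extendZero, h, hφ.eq_zero h]

/-- The restriction to `Ω` of a test function, as an element of `C_c(Ω)`. -/
def IsTest.toCompactlySupported (hφ : IsTest Ω φ) : C_c(Ω, ℝ) where
  toFun x := φ x
  continuous_toFun := hφ.1.continuous.comp continuous_subtype_val
  hasCompactSupport' := by
    have hK : IsCompact ((↑) ⁻¹' tsupport φ : Set Ω) :=
      Topology.IsInducing.subtypeVal.isCompact_preimage_iff (by simpa using hφ.2.2) |>.2 hφ.2.1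
    exact HasCompactSupport.intro hK fun x hx => image_eq_zero_of_notMem_tsupport hx

/-- A positive linear functional on test functions is integration against a Radon measure. It
extends to a positive functional on `C_c(Ω)` by the M. Riesz extension theorem, since every element
of `C_c(Ω)` is dominated by a multiple of a cutoff function. -/
theorem exists_regular_measure_of_nonneg (hΩ : IsOpen Ω) (T : ((Fin N → ℝ) → ℝ) → ℝ)
    (hadd : ∀ φ ψ, IsTest Ω φ → IsTest Ω ψ → T (fun x => φ x + ψ x) = T φ + T ψ)
    (hmul : ∀ (c : ℝ) φ, IsTest Ω φ → T (fun x => c * φ x) = c * T φ)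
    (hpos : ∀ φ, IsTest Ω φ → (∀ x, 0 ≤ φ x) → 0 ≤ T φ) :
    ∃ M : Measure Ω, M.Regular ∧ ∀ φ, IsTest Ω φ → T φ = ∫ x : Ω, φ x ∂M := by
  have : LocallyCompactSpace Ω := hΩ.locallyCompactSpace
  let p : Submodule ℝ C_c(Ω, ℝ) :=
    { carrier := {ψ | IsTest Ω (extendZero ψ)}
      zero_mem' := by
        have e : extendZero (⇑(0 : C_c(Ω, ℝ))) = fun _ => 0 := by
          funext x
          by_cases h : x ∈ Ω <;> simp [extendZero, h]
        change IsTest Ω (extendZero (⇑(0 : C_c(Ω, ℝ))))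
        rw [e]
        exact isTest_zero
      add_mem' := fun {a b} ha hb => by
        have := IsTest.add ha hb
        rw [← extendZero_add] at this
        exact this
      smul_mem' := fun c a ha => by
        have := IsTest.const_mul ha c
        rw [← extendZero_const_mul] at this
        exact this }
  let T₀ : C_c(Ω, ℝ) →ₗ.[ℝ] ℝ :=
    { domain := p
      toFun :=
        { toFun := fun ψ => T (extendZero ψ.1)
          map_add' := fun a b => by
            rw [← hadd _ _ a.2 b.2, ← extendZero_add]
            rfl
          map_smul' := fun c a => by
            rw [RingHom.id_apply, smul_eq_mul, ← hmul c _ a.2, ← extendZero_const_mul]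
            rfl } }
  let s : PointedCone ℝ C_c(Ω, ℝ) :=
    { carrier := {ψ | ∀ x, 0 ≤ ψ x}
      zero_mem' := fun x => le_rfl
      add_mem' := fun ha hb x => add_nonneg (ha x) (hb x)
      smul_mem' := fun c a ha x => mul_nonneg c.2 (ha x) }
  have hext : ∀ ψ : Ω → ℝ, (∀ x, 0 ≤ ψ x) → ∀ x, 0 ≤ extendZero ψ x := fun ψ hψ x => by
    by_cases h : x ∈ Ω
    · simpa [extendZero, h] using hψ _
    · simp [extendZero, h]
  obtain ⟨Λ, hΛT, hΛpos⟩ := riesz_extension s T₀ (fun ψ hψ => hpos _ ψ.2 (hext _ hψ)) (by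
    intro ψ
    have hK : IsCompact ((↑) '' tsupport ψ : Set (Fin N → ℝ)) :=
      IsCompact.image ψ.hasCompactSupport continuous_subtype_val
    obtain ⟨χ, hχ, hχ1, hχ01⟩ := exists_isTest_one_on hK hΩ (by rintro _ ⟨x, -, rfl⟩; exact x.2)
    obtain ⟨C, hC⟩ := ψ.continuous.bounded_above_of_compact_support ψ.hasCompactSupport
    have hCχ := hχ.const_mul |C|
    refine ⟨⟨hCχ.toCompactlySupported, ?_⟩, fun x => ?_⟩
    · change IsTest Ω (extendZero fun x : Ω => |C| * χ x)
      rw [hCχ.extendZero_restrict]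
      exact hCχ
    · change 0 ≤ |C| * χ x + ψ x
      by_cases hx : x ∈ tsupport ψ
      · rw [hχ1 x ⟨x, hx, rfl⟩]
        have h1 : |ψ x| ≤ C := hC x
        linarith [neg_abs_le (ψ x), le_abs_self C]
      · rw [image_eq_zero_of_notMem_tsupport hx, add_zero]
        exact mul_nonneg (abs_nonneg _) (hχ01 x).1)
  let Λ' : C_c(Ω, ℝ) →ₚ[ℝ] ℝ :=
    { Λ with
      monotone' := fun a b hab => by
        have h := hΛpos (b - a) fun x => sub_nonneg.2 (hab x)
        rw [map_sub] at h
        exact sub_nonneg.1 h }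
  refine ⟨RealRMK.rieszMeasure Λ', inferInstance, fun φ hφ => ?_⟩
  have h1 := RealRMK.integral_rieszMeasure Λ' hφ.toCompactlySupported
  have hmem : hφ.toCompactlySupported ∈ p := by
    change IsTest Ω (extendZero fun x : Ω => φ x)
    rw [hφ.extendZero_restrict]
    exact hφ
  have h2 : Λ hφ.toCompactlySupported = T (extendZero fun x : Ω => φ x) :=
    hΛT ⟨hφ.toCompactlySupported, hmem⟩
  rw [hφ.extendZero_restrict] at h2
  exact h2.symm.trans h1.symm

/-- A Radon measure does not charge an open set if it annihilates the test functions supported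
there. -/
lemma measure_image_eq_zero (hΩ : IsOpen Ω) (M : Measure Ω) [M.Regular] {S : Set Ω}
    (hS : IsOpen S) (h : ∀ φ, IsTest Ω φ → tsupport φ ⊆ (↑) '' S → ∫ x : Ω, φ x ∂M = 0) :
    M S = 0 := by
  rw [hS.measure_eq_iSup_isCompact]
  simp only [ENNReal.iSup_eq_zero]
  intro K hKS hK
  obtain ⟨χ, hχ, hχ1, hχ01⟩ := exists_isTest_one_on (hK.image continuous_subtype_val)
    (hΩ.isOpenMap_subtype_val S hS) (Set.image_mono hKS)
  have hχΩ : IsTest Ω χ := hχ.mono (by rintro _ ⟨x, -, rfl⟩; exact x.2)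
  have hi : Integrable (fun x : Ω => χ x) M :=
    hχΩ.toCompactlySupported.continuous.integrable_of_hasCompactSupport
      hχΩ.toCompactlySupported.hasCompactSupport
  have h0 := h χ hχΩ hχ.2.2
  rw [integral_eq_zero_iff_of_nonneg (f := fun x : Ω => χ x) (fun x => (hχ01 x).1) hi] at h0
  refine measure_mono_null (fun x hx => ?_) (ae_iff.1 h0)
  simp [hχ1 x ⟨x, hx, rfl⟩]

end Radon

end Stratified

end

theorem lemma6p1 {N : ℕ} (G : Stratified.StratifiedGroup N)
    (Ω : Set (Fin N → ℝ)) (hΩo : IsOpen Ω) (hΩc : IsConnected Ω) (hΩb : Bornology.IsBounded Ω)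
    (f : (Fin N → ℝ) → ℝ) (hf : MemLp f ⊤ (volume.restrict Ω))
    (hfpos : ∀ᵐ x ∂(volume.restrict Ω), 0 < f x)
    (lam : ℝ) (hlam : 0 < lam)
    (g : ℝ → ℝ) (hg : Stratified.IsBump g)
    (α : ℕ → ℝ) (hα : ∀ j, 0 < α j) (hα0 : Tendsto α atTop (𝓝 0))
    (uj : ℕ → (Fin N → ℝ) → ℝ)
    (hcrit : ∀ j, Stratified.IsCriticalPoint G Ω f lam g (α j) (uj j))
    (hW : ∃ C : ℝ, ∀ j, Stratified.w12Norm G Ω (uj j) ≤ C)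
    (hL : ∃ C : ℝ, ∀ j, ∀ᵐ x ∂(volume.restrict Ω), |uj j x| ≤ C)
    (u : (Fin N → ℝ) → ℝ) (hu : ContinuousOn u Ω)
    (hlim : TendstoUniformlyOn uj u atTop Ω) :
    Stratified.MemW12Loc G Ω u ∧
    ∃ M : Measure Ω, M.Regular ∧
      (∀ φ, Stratified.IsTest Ω φ →
        ∫ x in Ω, max (1 - u x) 0 * G.subLaplacian φ x = ∫ x : Ω, φ x ∂M) ∧
      M (frontier {x : Ω | u x < 1})ᶜ = 0 := by
  have : IsFiniteMeasure (volume.restrict Ω) := ⟨by simpa using hΩb.measure_lt_top⟩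
  have hu2 : MemLp u 2 (volume.restrict Ω) := Stratified.memLp_limit hΩo hL hu hlim
  refine ⟨fun Ω' _ _ hΩ' => (Stratified.memW12_of_tendstoUniformlyOn hΩo
    (fun j => (hcrit j).1.1) hW hu2 hlim).mono (subset_closure.trans hΩ'), ?_⟩
  obtain ⟨M, hM, hMφ⟩ := Stratified.exists_regular_measure_of_nonneg hΩo
    (fun φ => ∫ x in Ω, max (1 - u x) 0 * G.subLaplacian φ x)
    (fun φ ψ hφ hψ => by
      simp only [Stratified.subLaplacian_add G hφ hψ, mul_add]
      exact integral_add (Stratified.integrable_negPart_mul hu2 (hφ.subLaplacian G))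
        (Stratified.integrable_negPart_mul hu2 (hψ.subLaplacian G)))
    (fun c φ hφ => by
      simp only [Stratified.subLaplacian_const_mul G c hφ, mul_left_comm _ c]
      exact integral_const_mul _ _)
    (fun φ hφ hφ0 => Stratified.integral_negPart_subLaplacian_nonneg hΩo hf hg hα hcrit hL hu2
      hlim hφ hφ0)
  refine ⟨M, hM, hMφ, ?_⟩
  rw [compl_frontier_eq_union_interior, measure_union_null_iff]
  constructor
  · refine Stratified.measure_image_eq_zero hΩo M isOpen_interior fun φ hφ hs => ?_
    rw [← hMφ φ hφ]
    refine Stratified.integral_negPart_subLaplacian_eq_zero hΩo hf hg hα hcrit hL hu2 hu hlim hφ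
      fun x hx => ?_
    obtain ⟨y, hy, rfl⟩ := hs hx
    have hy1 : y ∈ {x : Ω | u x < 1} := interior_subset hy
    exact hy1
  · refine Stratified.measure_image_eq_zero hΩo M isOpen_interior fun φ hφ hs => ?_
    rw [← hMφ φ hφ]
    refine integral_eq_zero_of_ae (Eventually.of_forall fun x => ?_)
    by_cases hx : x ∈ tsupport φ
    · obtain ⟨y, hy, rfl⟩ := hs hx
      have hy1 : 1 ≤ u y := not_lt.1 (interior_subset hy)
      simp [max_eq_right (sub_nonpos.2 hy1)]
    · simp [Stratified.subLaplacian_eq_zero G hx]
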